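/- **Floating-point model.** A floating-point arithmetic with unit roundoff $u\ge 0$ evaluates each operation $\mathrm{op}\in\{+,-,*,/\}$ on real numbers, or on complex numbers, with a result $\mathit{fl}(x\ \mathrm{op}\ y)=(x\ \mathrm{op}\ y)(1+\delta)$, $|\delta|\le u$ (where $y\neq0$ for division; $\delta$ is real for real operations and complex for complex ones), and real square roots with $\mathit{fl}(\sqrt x)=\sqrt x\,(1+\delta)$, $|\delta|\le u$, for $x\ge0$. Negation, conjugation and comparison are exact. Sums of squares of moduli are evaluated with real operations on the real and imaginary parts. For a scalar $z$, $z^*=\overline z$. **One QR iteration.** The inputs are the diagonal $d$ and superdiagonal $\beta_i=a_{i,i+1}$ of a Hermitian $A\in\mathbb C^{n\times n}$, and $p,q\in\mathbb C^n$, where $A+pq^*$ is lower Hessenberg (its entries $(i,j)$ with $j>i+1$ vanish). All operations are carried out in floating-point arithmetic. *Elimination.* Set $\gamma\gets\overline\beta$, $\tilde q\gets q$. For $k=n,n-1,\dots,2$: 1. Set $x_1=\beta_{k-1}+p_{k-1}q_k^*$, $x_2=d_k+p_kq_k^*$ and $Q_k=\begin{pmatrix}c&-s\\ \overline s&\overline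 c\end{pmatrix}$, where $c=x_2/\sqrt{|x_1|^2+|x_2|^2}$, $s=x_1/\sqrt{|x_1|^2+|x_2|^2}$, and $c=1$, $s=0$ if $x_1=x_2=0$ (all as computed). 2. If $k\ne2$, set $\gamma_{k-2}\gets\bigl(Q_k(\gamma_{k-2},\,-\tilde q_kp_{k-2}^*)^T\bigr)_1$. 3. Set $(d_{k-1},\gamma_{k-1})^T\gets Q_k(d_{k-1},\gamma_{k-1})^T$, then $(\beta_{k-1},d_k)^T\gets Q_k(\beta_{k-1},d_k)^T$, then $(p_{k-1},p_k)^T\gets Q_k(p_{k-1},p_k)^T$. 4. If $|p_{k-1}q_k^*|^2+|p_kq_k^*|^2>|\beta_{k-1}|^2+|d_k|^2$ (both sides as computed from the updated values), set $p_{k-1}\gets-\beta_{k-1}/q_k^*$. 5. Set $(\tilde q_{k-1},\tilde q_k)^T\gets Q_k(\tilde q_{k-1},\tilde q_k)^T$. *Rotation back*, with the computed $Q_k$, $d$, $\gamma$, $p$ and the original $q$. For $k=n,n-1,\dots,2$: set $(d_{k-1},\beta_{k-1})^T\gets\overline{Q_k}\,(d_{k-1},-p_{k-1}q_k^*)^T$,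 then $d_k\gets\bigl(\overline{Q_k}(\gamma_{k-1},d_k)^T\bigr)_2$, then $(q_{k-1},q_k)^T\gets Q_k(q_{k-1},q_k)^T$. Let $\hat{\underline p}$ be the vector $p$ after the elimination and $\hat{\underline d},\hat{\underline\beta},\hat{\underline q}$ the vectors $d,\beta,q$ after the rotation back, and define $\hat{\underline A}\in\mathbb C^{n\times n}$ by $$\hat{\underline a}_{i,j}=\begin{cases}-\hat{\underline p}_i\hat{\underline q}_j^* & j>i+1,\\ \hat{\underline\beta}_i & j=i+1,\\ \hat{\underline d}_i & j=i,\\ \overline{\hat{\underline\beta}_j} & j=i-1,\\ -\hat{\underline q}_i\hat{\underline p}_j^* & j<i-1.\end{cases}$$ **Lemma 4.3.** There is a polynomial $P$ of degree at most $3$, and for every $n$ a number $u_0(n)>0$, such that the following holds for every $n$, every $0\le u\le u_0(n)$, every floating-point arithmetic with unit roundoff $u$, every Hermitian $A\in\mathbb C^{n\times n}$ and all $p,q\in\mathbb C^n$ with $A+pq^*$ lower Hessenberg. If one QR iteration is carried out in this floating-point arithmetic, then there exist a unitary $U\in\mathbb C^{n\times n}$, a matrix $\delta A\in\mathbb C^{n\times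 n}$ and vectors $\delta p,\delta q\in\mathbb C^n$ such that $$\hat{\underline A}=U(A+\delta A)U^*,\qquad \hat{\underline p}=U(p+\delta p),\qquad \hat{\underline q}=U(q+\delta q),$$ $$\|\delta A\|\le P(n)\,u\,\|A\|,\qquad \|\delta p\|\le P(n)\,u\,\|p\|,\qquad \|\delta q\|\le P(n)\,u\,\|q\|,$$ where $\|\cdot\|$ is the Frobenius norm for matrices and the Euclidean norm for vectors. -/

import Mathlib

open scoped Matrix Matrix.Norms.Frobenius

/-- The four rounded arithmetic operations on `K` (the real or the complex numbers) with unit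
roundoff `u`: each result is the exact one times `1 + δ` for some `δ` with `‖δ‖ ≤ u`. -/
structure RoundedOps (K : Type) [RCLike K] (u : ℝ) where
  add : K → K → K
  sub : K → K → K
  mul : K → K → K
  div : K → K → K
  add_spec : ∀ x y, ∃ δ : K, ‖δ‖ ≤ u ∧ add x y = (x + y) * (1 + δ)
  sub_spec : ∀ x y, ∃ δ : K, ‖δ‖ ≤ u ∧ sub x y = (x - y) * (1 + δ)
  mul_spec : ∀ x y, ∃ δ : K, ‖δ‖ ≤ u ∧ mul x y = (x * y) * (1 + δ)
  div_spec : ∀ x y, y ≠ 0 → ∃ δ : K, ‖δ‖ ≤ u ∧ div x y = (x / y) * (1 + δ)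

/-- A floating-point arithmetic with unit roundoff `u`: rounded real and complex arithmetic and a
rounded real square root. Negation, conjugation, comparison, taking real and imaginary parts and
the inclusion of the reals in the complex numbers are exact. -/
structure FloatArith (u : ℝ) where
  real : RoundedOps ℝ u
  cplx : RoundedOps ℂ u
  sqrt : ℝ → ℝ
  sqrt_spec : ∀ x, 0 ≤ x → ∃ δ : ℝ, ‖δ‖ ≤ u ∧ sqrt x = Real.sqrt x * (1 + δ)

namespace FloatArith

variable {u : ℝ} (F : FloatArith u)

/-- The floating-point value of `|x|² + |y|²`. -/
def normSq₂ (x y : ℂ) : ℝ :=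
  F.real.add (F.real.add (F.real.mul x.re x.re) (F.real.mul x.im x.im))
    (F.real.add (F.real.mul y.re y.re) (F.real.mul y.im y.im))

/-- The floating-point value of the rotation in `SU(2)` that eliminates the first entry of
`(x, y)ᵀ`: the matrix with rows `(c, -s)` and `(s̄, c̄)`, where `c = y / √(|x|² + |y|²)` and
`s = x / √(|x|² + |y|²)`, and `c = 1`, `s = 0` when `x = y = 0`. -/
noncomputable def rotation (x y : ℂ) : Matrix (Fin 2) (Fin 2) ℂ :=
  if x = 0 ∧ y = 0 then 1
  else
    let r : ℂ := (F.sqrt (F.normSq₂ x y) : ℝ)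
    let c := F.cplx.div y r
    let s := F.cplx.div x r
    !![c, -s; star s, star c]

/-- First entry of the floating-point product of `Q` and `(x, y)ᵀ`. -/
def apply₁ (Q : Matrix (Fin 2) (Fin 2) ℂ) (x y : ℂ) : ℂ :=
  F.cplx.add (F.cplx.mul (Q 0 0) x) (F.cplx.mul (Q 0 1) y)

/-- Second entry of the floating-point product of `Q` and `(x, y)ᵀ`. -/
def apply₂ (Q : Matrix (Fin 2) (Fin 2) ℂ) (x y : ℂ) : ℂ :=
  F.cplx.add (F.cplx.mul (Q 1 0) x) (F.cplx.mul (Q 1 1) y)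

/-- Overwrite the entries `j` and `j + 1` of `v` by the floating-point product of `Q` with them. -/
def rotateAt (Q : Matrix (Fin 2) (Fin 2) ℂ) (j : ℕ) (v : ℕ → ℂ) : ℕ → ℂ :=
  Function.update (Function.update v j (F.apply₁ Q (v j) (v (j + 1))))
    (j + 1) (F.apply₂ Q (v j) (v (j + 1)))

end FloatArith

/-- The variables of the elimination of the superdiagonal. Vectors are stored as sequences, and
all indices start from `0`: `d i`, `p i`, `qt i` (`i < n`) are the diagonal of the current matrix,
the vector `p` and the vector `q̃`; `β i` and `γ i` (`i < n - 1`) are the entries `(i, i + 1)` and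
`(i + 1, i)`; `Q j` is the computed rotation in the plane of the coordinates `j` and `j + 1`. -/
structure ElimState where
  d : ℕ → ℂ
  β : ℕ → ℂ
  γ : ℕ → ℂ
  p : ℕ → ℂ
  qt : ℕ → ℂ
  Q : ℕ → Matrix (Fin 2) (Fin 2) ℂ

namespace FloatArith

variable {u : ℝ} (F : FloatArith u)

/-- One pass of the elimination loop in floating-point arithmetic. It eliminates the superdiagonal
entry `(j, j + 1)` (rows counted from `0`) by a rotation of the rows `j` and `j + 1`. -/
noncomputable def elimStep (q : ℕ → ℂ) (j : ℕ) (s : ElimState) : ElimState :=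
  let Q := F.rotation
    (F.cplx.add (s.β j) (F.cplx.mul (s.p j) (star (q (j + 1)))))
    (F.cplx.add (s.d (j + 1)) (F.cplx.mul (s.p (j + 1)) (star (q (j + 1)))))
  -- rotate the subdiagonal and the sub-subdiagonal, unless these are the first two rows
  let γ' := if j = 0 then s.γ else
    Function.update s.γ (j - 1)
      (F.apply₁ Q (s.γ (j - 1)) (-F.cplx.mul (s.qt (j + 1)) (star (s.p (j - 1)))))
  -- rotate the diagonal and the subdiagonal
  let d' := Function.update s.d j (F.apply₁ Q (s.d j) (γ' j))
  let γ'' := Function.update γ' j (F.apply₂ Q (s.d j) (γ' j))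
  -- rotate the superdiagonal and the diagonal
  let β' := Function.update s.β j (F.apply₁ Q (s.β j) (d' (j + 1)))
  let d'' := Function.update d' (j + 1) (F.apply₂ Q (s.β j) (d' (j + 1)))
  -- rotate `p`, and correct it if necessary
  let p' := F.rotateAt Q j s.p
  let p'' :=
    if F.normSq₂ (F.cplx.mul (p' j) (star (q (j + 1))))
          (F.cplx.mul (p' (j + 1)) (star (q (j + 1))))
        > F.normSq₂ (β' j) (d'' (j + 1)) then
      Function.update p' j (-F.cplx.div (β' j) (star (q (j + 1))))
    else p'
  { d := d''
    β := β'
    γ := γ''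
    p := p''
    qt := F.rotateAt Q j s.qt
    Q := Function.update s.Q j Q }

/-- The passes `j = m - 1, m - 2, …, 0` of the elimination loop, in this order. -/
noncomputable def elimLoop (q : ℕ → ℂ) : ℕ → ElimState → ElimState
  | 0, s => s
  | m + 1, s => elimLoop q m (F.elimStep q m s)

/-- The elimination of the superdiagonal in floating-point arithmetic, for an `n × n` Hermitian
matrix with diagonal `d` and superdiagonal `β`. -/
noncomputable def eliminate (n : ℕ) (d β p q : ℕ → ℂ) : ElimState :=
  F.elimLoop q (n - 1)
    { d := d, β := β, γ := fun i => star (β i), p := p, qt := q, Q := fun _ => 1 }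

end FloatArith

/-- The variables of the rotation back to Hessenberg form, with the same index conventions. -/
structure BackState where
  d : ℕ → ℂ
  β : ℕ → ℂ
  q : ℕ → ℂ

namespace FloatArith

variable {u : ℝ} (F : FloatArith u)

/-- One pass of the loop that rotates back to Hessenberg form, in floating-point arithmetic: a
rotation of the columns `j` and `j + 1` (counted from `0`) by the conjugate of `Q j`. -/
def backStep (Q : ℕ → Matrix (Fin 2) (Fin 2) ℂ) (γ p : ℕ → ℂ) (j : ℕ) (s : BackState) :
    BackState :=
  let Qc := (Q j).map star
  -- rotate the diagonal and the superdiagonal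
  let t := -F.cplx.mul (p j) (star (s.q (j + 1)))
  let d' := Function.update s.d j (F.apply₁ Qc (s.d j) t)
  let β' := Function.update s.β j (F.apply₂ Qc (s.d j) t)
  -- rotate the subdiagonal and the diagonal
  let d'' := Function.update d' (j + 1) (F.apply₂ Qc (γ j) (d' (j + 1)))
  { d := d'', β := β', q := F.rotateAt (Q j) j s.q }

/-- The passes `j = m - 1, m - 2, …, 0` of the loop that rotates back, in this order. -/
def backLoop (Q : ℕ → Matrix (Fin 2) (Fin 2) ℂ) (γ p : ℕ → ℂ) : ℕ → BackState → BackState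
  | 0, s => s
  | m + 1, s => backLoop Q γ p m (F.backStep Q γ p m s)

/-- The rotation back to Hessenberg form in floating-point arithmetic. Every entry `β j` with
`j < n - 1` is assigned before the loop ends, so the initial value of `β` plays no role. -/
def rotateBack (n : ℕ) (Q : ℕ → Matrix (Fin 2) (Fin 2) ℂ) (d γ p q : ℕ → ℂ) : BackState :=
  F.backLoop Q γ p (n - 1) { d := d, β := fun _ => 0, q := q }

end FloatArith

/-- A vector of length `n` as a sequence (extended by `0`). -/
def vecSeq {n : ℕ} (v : Fin n → ℂ) (i : ℕ) : ℂ :=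
  if h : i < n then v ⟨i, h⟩ else 0

/-- The diagonal of a matrix as a sequence (extended by `0`). -/
def diagSeq {n : ℕ} (A : Matrix (Fin n) (Fin n) ℂ) (i : ℕ) : ℂ :=
  if h : i < n then A ⟨i, h⟩ ⟨i, h⟩ else 0

/-- The superdiagonal of a matrix as a sequence (extended by `0`). -/
def superdiagSeq {n : ℕ} (A : Matrix (Fin n) (Fin n) ℂ) (i : ℕ) : ℂ :=
  if h : i + 1 < n then A ⟨i, Nat.lt_of_succ_lt h⟩ ⟨i + 1, h⟩ else 0

/-- A matrix is lower Hessenberg if it vanishes above the superdiagonal. -/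
def IsLowerHessenberg {n : ℕ} (M : Matrix (Fin n) (Fin n) ℂ) : Prop :=
  ∀ i j : Fin n, (i : ℕ) + 1 < j → M i j = 0

/-- The matrix represented by the generators `d`, `β`, `p`, `q`. -/
def generatedMatrix (n : ℕ) (d β p q : ℕ → ℂ) : Matrix (Fin n) (Fin n) ℂ :=
  Matrix.of fun i j =>
    if (i : ℕ) + 1 < j then -(p i * star (q j))
    else if (j : ℕ) = i + 1 then β i
    else if (j : ℕ) = i then d i
    else if (i : ℕ) = j + 1 then star (β j)
    else -(q i * star (p j))

namespace FloatArith

variable {u : ℝ} (F : FloatArith u) {n : ℕ}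

/-- The elimination half of one QR iteration on `A + p q*`, in floating-point arithmetic. -/
noncomputable def qrElim (A : Matrix (Fin n) (Fin n) ℂ) (p q : Fin n → ℂ) : ElimState :=
  F.eliminate n (diagSeq A) (superdiagSeq A) (vecSeq p) (vecSeq q)

/-- The second half of one QR iteration: the rotation back to Hessenberg form, applied to the
output of the elimination. -/
noncomputable def qrBack (A : Matrix (Fin n) (Fin n) ℂ) (p q : Fin n → ℂ) : BackState :=
  F.rotateBack n (F.qrElim A p q).Q (F.qrElim A p q).d (F.qrElim A p q).γ (F.qrElim A p q).p
    (vecSeq q)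

/-- The vector `p` computed by one QR iteration. -/
noncomputable def qrP (A : Matrix (Fin n) (Fin n) ℂ) (p q : Fin n → ℂ) : Fin n → ℂ :=
  fun i => (F.qrElim A p q).p i

/-- The vector `q` computed by one QR iteration. -/
noncomputable def qrQ (A : Matrix (Fin n) (Fin n) ℂ) (p q : Fin n → ℂ) : Fin n → ℂ :=
  fun i => (F.qrBack A p q).q i

/-- The matrix `A` computed by one QR iteration, through its generators. -/
noncomputable def qrA (A : Matrix (Fin n) (Fin n) ℂ) (p q : Fin n → ℂ) :
    Matrix (Fin n) (Fin n) ℂ :=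
  generatedMatrix n (F.qrBack A p q).d (F.qrBack A p q).β (F.qrElim A p q).p (F.qrBack A p q).q

end FloatArith

/-! Each computed rotation is entrywise within `7 * u` of an exact one, found by normalising exactly
the computed pair to be eliminated. `U` is the product of these exact rotations, and the computed
data are compared entrywise with `U A`, `U A U*`, `U p` and `U q`. As `U` is unitary, forward errors
become backward errors of the same norm.

The difficulty lies in the entries represented only as products `-p_i q_k*`: an error of size `u
‖p‖` in `p` might cost `u ‖p‖ ‖q‖`, which `u ‖A‖` does not control. But a rotation perturbs `p` only
by a multiple of `u (|p_j| + |p_{j+1}|)`; times `|q_k|`, this is `u` times products that already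
approximate entries of a matrix of norm `‖A‖` (`norm_mul_sub_rotation_le`).

The exception is the superdiagonal entry being eliminated, where `p_j q_{j+1}*` and `p_{j+1}
q_{j+1}*` need not be matrix entries and may be huge. Here the correction of `p` acts
(`exists_isNearRotation_correction`). If the products dominate the matrix entries, `p_j` is
redefined to match the matrix entry, a change that is small relative to `p`. Otherwise the residual
is already small relative to the matrix.

In the elimination each pass combines a processed row with an untouched, hence exact, one: errors
add up to `O(n u ‖A‖)` (`ElimInvariant.step`). In the rotation back the fresh column carries that
error itself, so the total is `O(n² u ‖A‖)` per entry (`BackInvariant.step`). The Frobenius norm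
contributes the last factor `n`. -/

/-! ### Rounding errors of single operations -/

namespace RoundedOps

variable {K : Type} [RCLike K] {u : ℝ} (R : RoundedOps K u)

lemma norm_mul_one_add_sub_le {z δ : K} (h : ‖δ‖ ≤ u) : ‖z * (1 + δ) - z‖ ≤ u * ‖z‖ := by
  have : z * (1 + δ) - z = δ * z := by ring
  rw [this, norm_mul]
  gcongr

lemma norm_add_sub_le (x y : K) : ‖R.add x y - (x + y)‖ ≤ u * ‖x + y‖ := by
  obtain ⟨δ, hδ, h⟩ := R.add_spec x y
  rw [h]
  exact norm_mul_one_add_sub_le hδ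

lemma norm_mul_sub_le (x y : K) : ‖R.mul x y - x * y‖ ≤ u * ‖x * y‖ := by
  obtain ⟨δ, hδ, h⟩ := R.mul_spec x y
  rw [h]
  exact norm_mul_one_add_sub_le hδ

lemma norm_div_sub_le (x : K) {y : K} (hy : y ≠ 0) : ‖R.div x y - x / y‖ ≤ u * ‖x / y‖ := by
  obtain ⟨δ, hδ, h⟩ := R.div_spec x y hy
  rw [h]
  exact norm_mul_one_add_sub_le hδ

/-- The rounded sum of two approximations, measured against a common majorant. -/
lemma norm_add_sub_le_of_approx {a b a' b' : K} {α β k : ℝ} (hu : 0 ≤ u)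
    (ha : ‖a‖ ≤ α) (hb : ‖b‖ ≤ β) (ha' : ‖a' - a‖ ≤ k * α) (hb' : ‖b' - b‖ ≤ k * β) :
    ‖R.add a' b' - (a + b)‖ ≤ (k + u * (1 + k)) * (α + β) := by
  have h1 := R.norm_add_sub_le a' b'
  have h2 : ‖(a' + b') - (a + b)‖ ≤ k * (α + β) := by
    calc ‖(a' + b') - (a + b)‖ = ‖(a' - a) + (b' - b)‖ := by congr 1; ring
      _ ≤ _ := (norm_add_le _ _).trans (by linarith)
  have h3 : ‖a' + b'‖ ≤ (1 + k) * (α + β) := by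
    calc ‖a' + b'‖ = ‖((a' + b') - (a + b)) + (a + b)‖ := by congr 1; ring
      _ ≤ ‖(a' + b') - (a + b)‖ + ‖a + b‖ := norm_add_le _ _
      _ ≤ _ := by linarith [norm_add_le a b]
  calc ‖R.add a' b' - (a + b)‖ = ‖(R.add a' b' - (a' + b')) + ((a' + b') - (a + b))‖ := by
        congr 1; ring
    _ ≤ _ := norm_add_le _ _
    _ ≤ u * ((1 + k) * (α + β)) + k * (α + β) := by
        gcongr
        exact h1.trans (by gcongr)
    _ = _ := by ring

end RoundedOps

/-! ### Exact and computed plane rotations -/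

/-- `Q` is, up to entrywise errors `7 * u`, the rotation with rows `(c, -s)` and `(s̄, c̄)`. -/
structure IsNearRotation (u : ℝ) (Q : Matrix (Fin 2) (Fin 2) ℂ) (c s : ℂ) : Prop where
  unit : ‖c‖ ^ 2 + ‖s‖ ^ 2 = 1
  e00 : ‖Q 0 0 - c‖ ≤ 7 * u
  e01 : ‖Q 0 1 - -s‖ ≤ 7 * u
  e10 : ‖Q 1 0 - star s‖ ≤ 7 * u
  e11 : ‖Q 1 1 - star c‖ ≤ 7 * u

namespace IsNearRotation

variable {u : ℝ} {Q : Matrix (Fin 2) (Fin 2) ℂ} {c s : ℂ}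

lemma norm_c_le (h : IsNearRotation u Q c s) : ‖c‖ ≤ 1 := by
  have := h.unit
  exact abs_le_of_sq_le_sq' (by nlinarith [sq_nonneg ‖s‖]) zero_le_one |>.2

lemma norm_s_le (h : IsNearRotation u Q c s) : ‖s‖ ≤ 1 := by
  have := h.unit
  exact abs_le_of_sq_le_sq' (by nlinarith [sq_nonneg ‖c‖]) zero_le_one |>.2

/-- The rotation back acts on columns, by conjugated rotations. -/
lemma map_star (h : IsNearRotation u Q c s) :
    IsNearRotation u (Q.map star) (star c) (star s) where
  unit := by simpa using h.unit
  e00 := by simpa [← map_sub] using (norm_star (Q 0 0 - c)).trans_le h.e00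
  e01 := by
    have := (norm_star (Q 0 1 - -s)).trans_le h.e01
    rwa [star_sub, star_neg] at this
  e10 := by
    have := (norm_star (Q 1 0 - star s)).trans_le h.e10
    rwa [star_sub] at this
  e11 := by
    have := (norm_star (Q 1 1 - star c)).trans_le h.e11
    rwa [star_sub] at this

end IsNearRotation

/-- The inverse rotation recovers both entries. -/
lemma norm_add_norm_le_of_rotation {c s : ℂ} (h : ‖c‖ ^ 2 + ‖s‖ ^ 2 = 1) (x y : ℂ) :
    ‖x‖ + ‖y‖ ≤ 2 * (‖c * x - s * y‖ + ‖star s * x + star c * y‖) := by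
  have hc : ‖c‖ ≤ 1 :=
    abs_le_of_sq_le_sq' (by nlinarith [sq_nonneg ‖s‖]) zero_le_one |>.2
  have hs : ‖s‖ ≤ 1 :=
    abs_le_of_sq_le_sq' (by nlinarith [sq_nonneg ‖c‖]) zero_le_one |>.2
  have h' : star c * c + star s * s = 1 := by
    have e1 : star c * c = ((‖c‖ ^ 2 : ℝ) : ℂ) := by
      rw [Complex.star_def, ← Complex.normSq_eq_conj_mul_self, Complex.sq_norm]
    have e2 : star s * s = ((‖s‖ ^ 2 : ℝ) : ℂ) := by
      rw [Complex.star_def, ← Complex.normSq_eq_conj_mul_self, Complex.sq_norm]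
    rw [e1, e2, ← Complex.ofReal_add, h, Complex.ofReal_one]
  have hx : x = star c * (c * x - s * y) + s * (star s * x + star c * y) := by
    linear_combination (-x) * h'
  have hy : y = -star s * (c * x - s * y) + c * (star s * x + star c * y) := by
    linear_combination (-y) * h'
  have bx : ‖x‖ ≤ ‖c * x - s * y‖ + ‖star s * x + star c * y‖ := by
    conv_lhs => rw [hx]
    refine (norm_add_le _ _).trans ?_
    rw [norm_mul, norm_mul, norm_star]
    gcongr <;> exact mul_le_of_le_one_left (norm_nonneg _) ‹_›
  have bY : ‖y‖ ≤ ‖c * x - s * y‖ + ‖star s * x + star c * y‖ := by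
    conv_lhs => rw [hy]
    refine (norm_add_le _ _).trans ?_
    rw [norm_mul, norm_mul, norm_neg, norm_star]
    gcongr <;> exact mul_le_of_le_one_left (norm_nonneg _) ‹_›
  linarith

lemma norm_rotation_le {c s : ℂ} (hc : ‖c‖ ≤ 1) (hs : ‖s‖ ≤ 1) (x y : ℂ) :
    ‖c * x - s * y‖ ≤ ‖x‖ + ‖y‖ := by
  refine (norm_sub_le _ _).trans ?_
  rw [norm_mul, norm_mul]
  gcongr <;> exact mul_le_of_le_one_left (norm_nonneg _) ‹_›

lemma norm_rotation_le' {c s : ℂ} (hc : ‖c‖ ≤ 1) (hs : ‖s‖ ≤ 1) (x y : ℂ) :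
    ‖star s * x + star c * y‖ ≤ ‖x‖ + ‖y‖ := by
  have := norm_rotation_le (c := star s) (s := -star c) (by simpa) (by simpa) x y
  simpa using this

namespace FloatArith

variable {u : ℝ} (F : FloatArith u)

/-- To first order, `7 * u` comes from the coefficient, `u` from the product and `u` from the sum;
the tenth `u` absorbs higher orders. -/
lemma norm_add_mul_mul_sub_le (hu : 0 ≤ u) (hu' : u ≤ 1 / 1000) {a b a' b' : ℂ}
    (ha : ‖a' - a‖ ≤ 7 * u) (hb : ‖b' - b‖ ≤ 7 * u) (ha1 : ‖a‖ ≤ 1) (hb1 : ‖b‖ ≤ 1) (x y : ℂ) :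
    ‖F.cplx.add (F.cplx.mul a' x) (F.cplx.mul b' y) - (a * x + b * y)‖
      ≤ 10 * u * (‖x‖ + ‖y‖) := by
  have key : ∀ {a a' : ℂ}, ‖a' - a‖ ≤ 7 * u → ‖a‖ ≤ 1 → ∀ x,
      ‖F.cplx.mul a' x - a * x‖ ≤ (81 / 10 * u) * ‖x‖ := by
    intro a a' h h1 x
    have h2 := F.cplx.norm_mul_sub_le a' x
    have h3 : ‖a'‖ ≤ 1 + 7 * u := by
      calc ‖a'‖ = ‖(a' - a) + a‖ := by congr 1; ring
        _ ≤ _ := (norm_add_le _ _).trans (by linarith)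
    rw [norm_mul] at h2
    have hx := norm_nonneg x
    calc ‖F.cplx.mul a' x - a * x‖ = ‖(F.cplx.mul a' x - a' * x) + (a' - a) * x‖ := by
          congr 1; ring
      _ ≤ u * (‖a'‖ * ‖x‖) + ‖a' - a‖ * ‖x‖ := (norm_add_le _ _).trans (by rw [norm_mul]; gcongr)
      _ ≤ u * ((1 + 7 * u) * ‖x‖) + 7 * u * ‖x‖ := by gcongr
      _ = (u + 7 * u * u + 7 * u) * ‖x‖ := by ring
      _ ≤ _ := by gcongr; nlinarith
  have hx : ‖a * x‖ ≤ ‖x‖ := by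
    rw [norm_mul]; exact mul_le_of_le_one_left (norm_nonneg _) ha1
  have hy : ‖b * y‖ ≤ ‖y‖ := by
    rw [norm_mul]; exact mul_le_of_le_one_left (norm_nonneg _) hb1
  refine (F.cplx.norm_add_sub_le_of_approx hu hx hy (key ha ha1 x) (key hb hb1 y)).trans ?_
  gcongr
  nlinarith

lemma norm_apply₁_sub_le (hu : 0 ≤ u) (hu' : u ≤ 1 / 1000) {Q : Matrix (Fin 2) (Fin 2) ℂ}
    {c s : ℂ} (h : IsNearRotation u Q c s) (x y : ℂ) :
    ‖F.apply₁ Q x y - (c * x - s * y)‖ ≤ 10 * u * (‖x‖ + ‖y‖) := by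
  have := F.norm_add_mul_mul_sub_le hu hu' h.e00 h.e01 h.norm_c_le
    (by simpa using h.norm_s_le) x y
  rwa [neg_mul, ← sub_eq_add_neg] at this

lemma norm_apply₂_sub_le (hu : 0 ≤ u) (hu' : u ≤ 1 / 1000) {Q : Matrix (Fin 2) (Fin 2) ℂ}
    {c s : ℂ} (h : IsNearRotation u Q c s) (x y : ℂ) :
    ‖F.apply₂ Q x y - (star s * x + star c * y)‖ ≤ 10 * u * (‖x‖ + ‖y‖) :=
  F.norm_add_mul_mul_sub_le hu hu' h.e10 h.e11 (by simpa using h.norm_s_le)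
    (by simpa using h.norm_c_le) x y

/-- All summands are nonnegative, so nothing cancels, and each goes through three roundings; the
fourth `u` absorbs higher orders. -/
lemma abs_normSq₂_sub_le (hu : 0 ≤ u) (hu' : u ≤ 1 / 1000) (x y : ℂ) :
    |F.normSq₂ x y - (‖x‖ ^ 2 + ‖y‖ ^ 2)| ≤ 4 * u * (‖x‖ ^ 2 + ‖y‖ ^ 2) := by
  have hm : ∀ a : ℝ, ‖F.real.mul a a - a * a‖ ≤ u * (a * a) := fun a => by
    simpa [abs_mul_abs_self] using F.real.norm_mul_sub_le a a
  have hn : ∀ a : ℝ, ‖a * a‖ ≤ a * a := fun a => by simp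
  have ha := fun z : ℂ => F.real.norm_add_sub_le_of_approx hu (hn z.re) (hn z.im) (hm _) (hm _)
  have hz : ∀ z : ℂ, z.re * z.re + z.im * z.im = ‖z‖ ^ 2 := fun z => by
    rw [Complex.sq_norm, Complex.normSq_apply]
  have hz' : ∀ z : ℂ, ‖‖z‖ ^ 2‖ ≤ ‖z‖ ^ 2 := fun z => by simp
  simp only [hz] at ha
  have := F.real.norm_add_sub_le_of_approx hu (hz' x) (hz' y) (ha x) (ha y)
  rw [Real.norm_eq_abs] at this
  refine this.trans ?_
  have h2 : u * u ≤ 1 / 1000 * u := by gcongr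
  have h3 : u * (u * u) ≤ 1 / 1000 * (1 / 1000 * u) := by gcongr
  gcongr
  linarith

/-- The witness is the pair normalised by its exact length, so it annihilates the pair exactly. The
budget is `4 * u` for the sum of squares, `u` for the root and `u` for the division, rounded up to
`7 * u`. -/
lemma exists_isNearRotation (hu : 0 ≤ u) (hu' : u ≤ 1 / 1000) (x y : ℂ) :
    ∃ c s : ℂ, IsNearRotation u (F.rotation x y) c s ∧ c * x - s * y = 0 := by
  by_cases h0 : x = 0 ∧ y = 0
  · refine ⟨1, 0, ⟨by simp, ?_, ?_, ?_, ?_⟩, by simp [h0.1]⟩ <;>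
      simp [rotation, h0, hu]
  set S : ℝ := ‖x‖ ^ 2 + ‖y‖ ^ 2 with hS
  have hS0 : 0 < S := by
    rcases not_and_or.mp h0 with h | h
    · have := norm_pos_iff.mpr h; positivity
    · have := norm_pos_iff.mpr h; positivity
  set ρ : ℝ := √S with hρ
  have hρ0 : 0 < ρ := Real.sqrt_pos.mpr hS0
  have hρ2 : ρ ^ 2 = S := Real.sq_sqrt hS0.le
  have hN := F.abs_normSq₂_sub_le hu hu' x y
  rw [← hS] at hN
  set S' := F.normSq₂ x y with hS'
  have hS'0 : 0 ≤ S' := by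
    have := (abs_le.mp hN).1
    nlinarith
  obtain ⟨δ, hδ, hr⟩ := F.sqrt_spec S' hS'0
  have h1 : |√S' - ρ| ≤ 4 * u * ρ := by
    have e : (√S' - ρ) * (√S' + ρ) = S' - S := by
      rw [← hρ2]; nth_rewrite 3 [← Real.sq_sqrt hS'0]; ring
    have e2 : |√S' - ρ| * (√S' + ρ) ≤ 4 * u * ρ * ρ := by
      have hp : 0 ≤ √S' + ρ := by positivity
      rw [← abs_of_nonneg hp, ← abs_mul, e, mul_assoc, ← sq, hρ2]
      exact hN
    have e3 : |√S' - ρ| * ρ ≤ |√S' - ρ| * (√S' + ρ) := by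
      gcongr
      linarith [Real.sqrt_nonneg S']
    exact le_of_mul_le_mul_right (e3.trans e2) hρ0
  set r := F.sqrt S' with hrdef
  have h2 : |r - ρ| ≤ 51 / 10 * u * ρ := by
    have e : r - ρ = δ * √S' + (√S' - ρ) := by rw [hr]; ring
    have e2 : √S' ≤ (1 + 4 * u) * ρ := by linarith [(abs_le.mp h1).2]
    rw [e]
    calc _ ≤ |δ| * √S' + |√S' - ρ| := by
          refine (abs_add_le _ _).trans ?_
          rw [abs_mul, abs_of_nonneg (Real.sqrt_nonneg S')]
      _ ≤ u * ((1 + 4 * u) * ρ) + 4 * u * ρ := by gcongr; simpa using hδ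
      _ = (u * (1 + 4 * u) + 4 * u) * ρ := by ring
      _ ≤ _ := by gcongr; nlinarith
  have hr0 : 0 < r := by
    have := (abs_le.mp h2).1
    nlinarith
  have hrC : (r : ℂ) ≠ 0 := by exact_mod_cast hr0.ne'
  have hρC : (ρ : ℂ) ≠ 0 := by exact_mod_cast hρ0.ne'
  have key : ∀ z : ℂ, ‖z‖ ≤ ρ → ‖F.cplx.div z r - z / ρ‖ ≤ 7 * u := by
    intro z hz
    have e1 : ‖z / r - z / ρ‖ ≤ 52 / 10 * u := by
      have : z / r - z / ρ = z * ((ρ - r : ℝ) : ℂ) / (r * ρ : ℝ) := by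
        push_cast; field_simp
      rw [this, norm_div, norm_mul, Complex.norm_real, Complex.norm_real, Real.norm_eq_abs,
        Real.norm_eq_abs, abs_of_pos (mul_pos hr0 hρ0), abs_sub_comm,
        div_le_iff₀ (mul_pos hr0 hρ0)]
      have hr' : (1 - 51 / 10 * u) * ρ ≤ r := by linarith [(abs_le.mp h2).1]
      calc ‖z‖ * |r - ρ| ≤ ρ * (51 / 10 * u * ρ) := by gcongr
        _ = 51 / 10 * u * (ρ * ρ) := by ring
        _ ≤ 52 / 10 * u * ((1 - 51 / 10 * u) * (ρ * ρ)) := by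
            have : 0 ≤ u * (ρ * ρ) := by positivity
            nlinarith
        _ = 52 / 10 * u * ((1 - 51 / 10 * u) * ρ * ρ) := by ring
        _ ≤ _ := by gcongr
    have e2 : ‖z / ρ‖ ≤ 1 := by
      rw [norm_div, Complex.norm_real, Real.norm_eq_abs, abs_of_pos hρ0]
      exact (div_le_one hρ0).mpr hz
    have e3 : ‖z / r‖ ≤ 1 + 52 / 10 * u := by
      calc ‖z / r‖ = ‖(z / r - z / ρ) + z / ρ‖ := by congr 1; ring
        _ ≤ _ := (norm_add_le _ _).trans (by linarith)
    have e4 := F.cplx.norm_div_sub_le z hrC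
    calc ‖F.cplx.div z r - z / ρ‖ = ‖(F.cplx.div z r - z / r) + (z / r - z / ρ)‖ := by
          congr 1; ring
      _ ≤ u * (1 + 52 / 10 * u) + 52 / 10 * u := (norm_add_le _ _).trans (by
          gcongr
          exact e4.trans (by gcongr))
      _ ≤ _ := by nlinarith
  have hx : ‖x‖ ≤ ρ := Real.le_sqrt_of_sq_le (by rw [hS]; nlinarith [sq_nonneg ‖y‖])
  have hy : ‖y‖ ≤ ρ := Real.le_sqrt_of_sq_le (by rw [hS]; nlinarith [sq_nonneg ‖x‖])
  have hQ : F.rotation x y = !![F.cplx.div y r, -F.cplx.div x r;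
      star (F.cplx.div x r), star (F.cplx.div y r)] := by
    simp [rotation, h0, hrdef, hS']
  refine ⟨y / ρ, x / ρ, ⟨?_, ?_, ?_, ?_, ?_⟩, by ring⟩
  · rw [norm_div, norm_div, Complex.norm_real, Real.norm_eq_abs, abs_of_pos hρ0, div_pow, div_pow,
      hρ2, ← add_div, add_comm, ← hS, div_self hS0.ne']
  · simpa [hQ] using key y hy
  · have : -F.cplx.div x r - -(x / ρ) = -(F.cplx.div x r - x / ρ) := by ring
    rw [hQ]
    simp only [Matrix.of_apply, Matrix.cons_val', Matrix.cons_val_zero, Matrix.cons_val_one,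
      Matrix.cons_val_fin_one]
    rw [this, norm_neg]
    exact key x hx
  · rw [hQ]
    simp only [Matrix.of_apply, Matrix.cons_val', Matrix.cons_val_zero, Matrix.cons_val_one,
      Matrix.cons_val_fin_one]
    rw [← star_sub, norm_star]
    exact key x hx
  · rw [hQ]
    simp only [Matrix.of_apply, Matrix.cons_val', Matrix.cons_val_one, Matrix.cons_val_fin_one]
    rw [← star_sub, norm_star]
    exact key y hy

end FloatArith

/-! ### The eliminated entry and the correction of `p` -/

namespace FloatArith

variable {u : ℝ} (F : FloatArith u)

/-- Together with `norm_add_le_apply`, this makes sizes before and after a computed rotation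
comparable, so that the test deciding the correction can be read on the data before the rotation. -/
lemma norm_apply_add_le (hu : 0 ≤ u) (hu' : u ≤ 1 / 1000) {Q : Matrix (Fin 2) (Fin 2) ℂ}
    {c s : ℂ} (h : IsNearRotation u Q c s) (x y : ℂ) :
    ‖F.apply₁ Q x y‖ + ‖F.apply₂ Q x y‖ ≤ 4 * (‖x‖ + ‖y‖) := by
  have h1 := norm_le_norm_add_norm_sub' (F.apply₁ Q x y) (c * x - s * y)
  have h2 := norm_le_norm_add_norm_sub' (F.apply₂ Q x y) (star s * x + star c * y)
  have h3 := F.norm_apply₁_sub_le hu hu' h x y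
  have h4 := F.norm_apply₂_sub_le hu hu' h x y
  have h5 := norm_rotation_le h.norm_c_le h.norm_s_le x y
  have h6 := norm_rotation_le' h.norm_c_le h.norm_s_le x y
  have h7 : 10 * u * (‖x‖ + ‖y‖) ≤ 10 * (1 / 1000) * (‖x‖ + ‖y‖) := by gcongr
  linarith [norm_nonneg x, norm_nonneg y]

lemma norm_add_le_apply (hu : 0 ≤ u) (hu' : u ≤ 1 / 1000) {Q : Matrix (Fin 2) (Fin 2) ℂ}
    {c s : ℂ} (h : IsNearRotation u Q c s) (x y : ℂ) :
    ‖x‖ + ‖y‖ ≤ 4 * (‖F.apply₁ Q x y‖ + ‖F.apply₂ Q x y‖) := by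
  have h1 := norm_le_norm_add_norm_sub (F.apply₁ Q x y) (c * x - s * y)
  have h2 := norm_le_norm_add_norm_sub (F.apply₂ Q x y) (star s * x + star c * y)
  have h3 := F.norm_apply₁_sub_le hu hu' h x y
  have h4 := F.norm_apply₂_sub_le hu hu' h x y
  have h5 := norm_add_norm_le_of_rotation h.unit x y
  have h7 : 10 * u * (‖x‖ + ‖y‖) ≤ 10 * (1 / 1000) * (‖x‖ + ‖y‖) := by gcongr
  linarith [norm_nonneg x, norm_nonneg y]

/-- Passing from Euclidean lengths to sums of moduli costs `√2`; the slack up to 2 covers the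
rounding of both values. -/
lemma norm_add_norm_le_of_normSq₂_le (hu : 0 ≤ u) (hu' : u ≤ 1 / 1000) {v₁ v₂ w₁ w₂ : ℂ}
    (h : F.normSq₂ v₁ v₂ ≤ F.normSq₂ w₁ w₂) : ‖v₁‖ + ‖v₂‖ ≤ 2 * (‖w₁‖ + ‖w₂‖) := by
  have hv := (abs_le.mp (F.abs_normSq₂_sub_le hu hu' v₁ v₂)).1
  have hw := (abs_le.mp (F.abs_normSq₂_sub_le hu hu' w₁ w₂)).2
  have hv' : 4 * u * (‖v₁‖ ^ 2 + ‖v₂‖ ^ 2) ≤ 4 * (1 / 1000) * (‖v₁‖ ^ 2 + ‖v₂‖ ^ 2) := by gcongr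
  have hw' : 4 * u * (‖w₁‖ ^ 2 + ‖w₂‖ ^ 2) ≤ 4 * (1 / 1000) * (‖w₁‖ ^ 2 + ‖w₂‖ ^ 2) := by gcongr
  refine abs_le_of_sq_le_sq' ?_ (by positivity) |>.2
  nlinarith [sq_nonneg (‖v₁‖ - ‖v₂‖), mul_nonneg (norm_nonneg w₁) (norm_nonneg w₂)]

lemma norm_mul_le_two_mul (hu' : u ≤ 1 / 1000) (x y : ℂ) :
    ‖F.cplx.mul x y‖ ≤ 2 * ‖x * y‖ := by
  have h1 := norm_le_norm_add_norm_sub' (F.cplx.mul x y) (x * y)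
  have h2 := F.cplx.norm_mul_sub_le x y
  have h3 : u * ‖x * y‖ ≤ 1 / 1000 * ‖x * y‖ := by gcongr
  linarith [norm_nonneg (x * y)]

lemma norm_mul_le_two_mul' (hu' : u ≤ 1 / 1000) (x y : ℂ) :
    ‖x * y‖ ≤ 2 * ‖F.cplx.mul x y‖ := by
  have h1 := norm_le_norm_add_norm_sub (F.cplx.mul x y) (x * y)
  have h2 := F.cplx.norm_mul_sub_le x y
  have h3 : u * ‖x * y‖ ≤ 1 / 1000 * ‖x * y‖ := by gcongr
  linarith [norm_nonneg (x * y)]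

lemma norm_add_mul_sub_le (hu : 0 ≤ u) (hu' : u ≤ 1 / 1000) (b x z : ℂ) :
    ‖F.cplx.add b (F.cplx.mul x z) - (b + x * z)‖ ≤ 3 * u * (‖b‖ + ‖x * z‖) := by
  refine (F.cplx.norm_add_sub_le_of_approx (k := u) hu le_rfl le_rfl ?_
    (F.cplx.norm_mul_sub_le x z)).trans ?_
  · simpa using mul_nonneg hu (norm_nonneg b)
  · gcongr
    nlinarith

/-- The rotation computed by an elimination step is close to an exact one that eliminates the
superdiagonal entry up to a small residual. -/
lemma exists_isNearRotation_residual (hu : 0 ≤ u) (hu' : u ≤ 1 / 1000) (b a x y z : ℂ)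
    {Q : Matrix (Fin 2) (Fin 2) ℂ}
    (hQ : Q = F.rotation (F.cplx.add b (F.cplx.mul x z)) (F.cplx.add a (F.cplx.mul y z))) :
    ∃ c s : ℂ, IsNearRotation u Q c s ∧ ‖F.apply₁ Q b a + F.apply₁ Q x y * z‖
      ≤ 13 * u * ((‖b‖ + ‖a‖) + (‖x‖ + ‖y‖) * ‖z‖) := by
  set f := F.cplx.add b (F.cplx.mul x z) with hf
  set g := F.cplx.add a (F.cplx.mul y z) with hg
  obtain ⟨c, s, h, h0⟩ := F.exists_isNearRotation hu hu' f g
  rw [← hQ] at h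
  refine ⟨c, s, h, ?_⟩
  have h1 := F.norm_add_mul_sub_le hu hu' b x z
  have h2 := F.norm_add_mul_sub_le hu hu' a y z
  rw [← hf] at h1
  rw [← hg] at h2
  have h3 := F.norm_apply₁_sub_le hu hu' h b a
  have h4 := F.norm_apply₁_sub_le hu hu' h x y
  -- The exact rotation annihilates `(f, g)`. What remains is `10 * u` from applying the computed
  -- rotation and `3 * u` from forming `f` and `g`.
  have e : F.apply₁ Q b a + F.apply₁ Q x y * z
      = (F.apply₁ Q b a - (c * b - s * a)) + (F.apply₁ Q x y - (c * x - s * y)) * z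
        - (c * (f - (b + x * z)) - s * (g - (a + y * z))) := by
    linear_combination h0
  have h5 := norm_rotation_le h.norm_c_le h.norm_s_le (f - (b + x * z)) (g - (a + y * z))
  rw [norm_mul] at h1 h2
  rw [e]
  refine (norm_sub_le _ _).trans ((add_le_add_left (norm_add_le _ _) _).trans ?_)
  rw [norm_mul]
  have h6 : ‖F.apply₁ Q x y - (c * x - s * y)‖ * ‖z‖ ≤ 10 * u * (‖x‖ + ‖y‖) * ‖z‖ := by gcongr
  nlinarith

/-- The correction of `p` in an elimination step is a small relative change of `p`, and it makes
the residual of the eliminated entry small relative to the entries of the matrix. -/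
lemma exists_isNearRotation_correction (hu : 0 ≤ u) (hu' : u ≤ 1 / 1000) (b a x y z : ℂ)
    {Q : Matrix (Fin 2) (Fin 2) ℂ} {x' : ℂ}
    (hQ : Q = F.rotation (F.cplx.add b (F.cplx.mul x z)) (F.cplx.add a (F.cplx.mul y z)))
    (hx' : x' = if F.normSq₂ (F.cplx.mul (F.apply₁ Q x y) z) (F.cplx.mul (F.apply₂ Q x y) z)
        > F.normSq₂ (F.apply₁ Q b a) (F.apply₂ Q b a) then -F.cplx.div (F.apply₁ Q b a) z
      else F.apply₁ Q x y) :
    ∃ c s : ℂ, IsNearRotation u Q c s ∧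
      ‖x' - (c * x - s * y)‖ ≤ 2000 * u * (‖x‖ + ‖y‖) ∧
      ‖F.apply₁ Q b a + x' * z‖ ≤ 2000 * u * (‖b‖ + ‖a‖) := by
  obtain ⟨c, s, h, hres⟩ := F.exists_isNearRotation_residual hu hu' b a x y z hQ
  refine ⟨c, s, h, ?_⟩
  have hp := F.norm_apply₁_sub_le hu hu' h x y
  have t1 := F.norm_apply_add_le hu hu' h b a
  have t2 := F.norm_add_le_apply hu hu' h b a
  have t3 := F.norm_apply_add_le hu hu' h x y
  have t4 := F.norm_add_le_apply hu hu' h x y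
  have m1 := F.norm_mul_le_two_mul hu' (F.apply₁ Q x y) z
  have m2 := F.norm_mul_le_two_mul hu' (F.apply₂ Q x y) z
  have m3 := F.norm_mul_le_two_mul' hu' (F.apply₁ Q x y) z
  have m4 := F.norm_mul_le_two_mul' hu' (F.apply₂ Q x y) z
  rw [norm_mul] at m1 m2 m3 m4
  set β' := F.apply₁ Q b a
  set d' := F.apply₂ Q b a
  set p' := F.apply₁ Q x y
  set r' := F.apply₂ Q x y
  have t3z := mul_le_mul_of_nonneg_right t3 (norm_nonneg z)
  have t4z := mul_le_mul_of_nonneg_right t4 (norm_nonneg z)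
  have hT1 : 0 ≤ ‖b‖ + ‖a‖ := by positivity
  have hT2 : 0 ≤ ‖x‖ + ‖y‖ := by positivity
  by_cases hc : F.normSq₂ (F.cplx.mul p' z) (F.cplx.mul r' z) > F.normSq₂ β' d'
  -- The products dominate. The new entry matches `β'` up to one division error, and the change of
  -- `p'`, multiplied by `z`, is a difference of two residuals that the products control.
  · rw [if_pos hc] at hx'
    have k := F.norm_add_norm_le_of_normSq₂_le hu hu' hc.le
    -- For `z = 0` both computed products vanish and the strict test fails.
    have hz : z ≠ 0 := by
      rintro rfl
      have hl := (abs_le.mp (F.abs_normSq₂_sub_le hu hu' (F.cplx.mul p' 0) (F.cplx.mul r' 0))).2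
      have hr := (abs_le.mp (F.abs_normSq₂_sub_le hu hu' β' d')).1
      have e1 : F.cplx.mul p' 0 = 0 := by
        obtain ⟨δ, -, e⟩ := F.cplx.mul_spec p' 0
        simpa using e
      have e2 : F.cplx.mul r' 0 = 0 := by
        obtain ⟨δ, -, e⟩ := F.cplx.mul_spec r' 0
        simpa using e
      rw [e1, e2] at hl hc
      simp only [norm_zero] at hl
      have : 4 * u * (‖β'‖ ^ 2 + ‖d'‖ ^ 2) ≤ 4 * (1 / 1000) * (‖β'‖ ^ 2 + ‖d'‖ ^ 2) := by gcongr
      nlinarith [sq_nonneg ‖β'‖, sq_nonneg ‖d'‖]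
    have hz0 : 0 < ‖z‖ := norm_pos_iff.mpr hz
    have hd := F.cplx.norm_div_sub_le β' hz
    have e1 : β' + x' * z = -(F.cplx.div β' z - β' / z) * z := by
      rw [hx']; field_simp; ring
    -- 16 = 2 · 2 · 4, from the test, the rounded products and the rotation of `(x, y)`.
    have hβ : ‖β'‖ ≤ 16 * ((‖x‖ + ‖y‖) * ‖z‖) := by
      linarith [norm_nonneg d']
    have e2 : ‖β' + x' * z‖ ≤ u * ‖β'‖ := by
      rw [e1, norm_mul, norm_neg]
      calc _ ≤ u * ‖β' / z‖ * ‖z‖ := by gcongr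
        _ = u * ‖β'‖ := by rw [norm_div]; field_simp
    -- Undoing the rotation of `(b, a)` costs another factor 4, and 65 = 1 + 4 · 16.
    have hS : (‖b‖ + ‖a‖) + (‖x‖ + ‖y‖) * ‖z‖ ≤ 65 * ((‖x‖ + ‖y‖) * ‖z‖) := by linarith
    refine ⟨?_, ?_⟩
    · have e3 : ‖(x' - p') * z‖ ≤ 861 * u * (‖x‖ + ‖y‖) * ‖z‖ := by
        have : (x' - p') * z = (β' + x' * z) - (β' + p' * z) := by ring
        rw [this]
        calc _ ≤ u * ‖β'‖ + 13 * u * ((‖b‖ + ‖a‖) + (‖x‖ + ‖y‖) * ‖z‖) :=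
              (norm_sub_le _ _).trans (add_le_add e2 hres)
          _ ≤ u * (16 * ((‖x‖ + ‖y‖) * ‖z‖)) + 13 * u * (65 * ((‖x‖ + ‖y‖) * ‖z‖)) := by gcongr
          _ = _ := by ring
      rw [norm_mul] at e3
      have e4 := le_of_mul_le_mul_right e3 hz0
      have e5 : x' - (c * x - s * y) = (x' - p') + (p' - (c * x - s * y)) := by ring
      rw [e5]
      refine (norm_add_le _ _).trans ?_
      nlinarith [mul_nonneg hu hT2]
    · calc _ ≤ u * ‖β'‖ := e2
        _ ≤ u * (4 * (‖b‖ + ‖a‖)) := by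
            gcongr
            linarith [norm_nonneg d']
        _ ≤ _ := by nlinarith [mul_nonneg hu hT1]
  -- The matrix entries dominate: the products in the residual are absorbed by `‖b‖ + ‖a‖`.
  · rw [if_neg hc] at hx'
    have k := F.norm_add_norm_le_of_normSq₂_le hu hu' (not_lt.mp hc)
    rw [hx']
    refine ⟨hp.trans (by gcongr; norm_num), hres.trans ?_⟩
    have hS : (‖b‖ + ‖a‖) + (‖x‖ + ‖y‖) * ‖z‖ ≤ 65 * (‖b‖ + ‖a‖) := by linarith
    calc _ ≤ 13 * u * (65 * (‖b‖ + ‖a‖)) := by gcongr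
      _ ≤ _ := by nlinarith [mul_nonneg hu hT1]

end FloatArith

/-- Propagation of errors through a rotation of approximate data `x * z ≈ X`, `y * z ≈ Y`. -/
lemma norm_mul_sub_rotation_le {u N e₁ e₂ e k : ℝ} {c s w x y z X Y : ℂ} (hu : 0 ≤ u) (hk : 0 ≤ k)
    (hc : ‖c‖ ≤ 1) (hs : ‖s‖ ≤ 1) (hw : ‖w - (c * x - s * y)‖ ≤ k * u * (‖x‖ + ‖y‖))
    (hx : ‖x * z - X‖ ≤ e₁) (hy : ‖y * z - Y‖ ≤ e₂) (hX : ‖X‖ ≤ N) (hY : ‖Y‖ ≤ N)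
    (hN : e₁ + e₂ ≤ 3 * N) (he : e₁ + e₂ + 5 * k * u * N ≤ e) :
    ‖w * z - (c * X - s * Y)‖ ≤ e := by
  have h1 : ‖x‖ * ‖z‖ ≤ N + e₁ := by
    have := norm_le_norm_add_norm_sub' (x * z) X
    rw [norm_mul] at this
    linarith
  have h2 : ‖y‖ * ‖z‖ ≤ N + e₂ := by
    have := norm_le_norm_add_norm_sub' (y * z) Y
    rw [norm_mul] at this
    linarith
  have e0 : w * z - (c * X - s * Y)
      = (w - (c * x - s * y)) * z + (c * (x * z - X) - s * (y * z - Y)) := by ring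
  rw [e0]
  refine (norm_add_le _ _).trans ?_
  have h3 := norm_rotation_le hc hs (x * z - X) (y * z - Y)
  rw [norm_mul]
  -- The error of `w` enters only through `‖x * z‖ + ‖y * z‖`, at most `2 * N + e₁ + e₂ ≤ 5 * N`; no
  -- separate bounds on the factors are used.
  have h4 : ‖w - (c * x - s * y)‖ * ‖z‖ ≤ 5 * k * u * N := by
    calc _ ≤ k * u * (‖x‖ + ‖y‖) * ‖z‖ := by gcongr
      _ = k * u * (‖x‖ * ‖z‖ + ‖y‖ * ‖z‖) := by ring
      _ ≤ k * u * (5 * N) := by gcongr; linarith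
      _ = _ := by ring
  linarith

/-- The entries of a matrix as a double sequence (extended by `0`). -/
def matSeq {n : ℕ} (M : Matrix (Fin n) (Fin n) ℂ) (i k : ℕ) : ℂ :=
  if h : i < n ∧ k < n then M ⟨i, h.1⟩ ⟨k, h.2⟩ else 0

/-! ### Entries as sequences and unitarily invariant norms -/

section Seq

variable {n : ℕ}

lemma vecSeq_of_lt (v : Fin n → ℂ) {i : ℕ} (h : i < n) : vecSeq v i = v ⟨i, h⟩ := dif_pos h

@[simp] lemma vecSeq_fin (v : Fin n → ℂ) (i : Fin n) : vecSeq v i = v i := dif_pos i.2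

@[simp] lemma matSeq_fin (M : Matrix (Fin n) (Fin n) ℂ) (i k : Fin n) :
    matSeq M i k = M i k := dif_pos ⟨i.2, k.2⟩

lemma matSeq_of_lt (M : Matrix (Fin n) (Fin n) ℂ) {i k : ℕ} (hi : i < n) (hk : k < n) :
    matSeq M i k = M ⟨i, hi⟩ ⟨k, hk⟩ := dif_pos ⟨hi, hk⟩

lemma matSeq_eq_vecSeq (M : Matrix (Fin n) (Fin n) ℂ) (i : ℕ) (k : Fin n) :
    matSeq M i k = vecSeq (fun r => M r k) i := by
  by_cases hi : i < n <;> simp [matSeq, vecSeq, hi]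

lemma matSeq_of_not_lt (M : Matrix (Fin n) (Fin n) ℂ) (i : ℕ) {k : ℕ} (hk : ¬ k < n) :
    matSeq M i k = 0 := by
  simp [matSeq, hk]

lemma matSeq_conjTranspose (M : Matrix (Fin n) (Fin n) ℂ) (i k : ℕ) :
    matSeq Mᴴ i k = star (matSeq M k i) := by
  by_cases hi : i < n <;> by_cases hk : k < n <;> simp [matSeq, hi, hk]

lemma vecSeq_injective : Function.Injective (vecSeq : (Fin n → ℂ) → ℕ → ℂ) := by
  intro v w h
  ext i
  rw [← vecSeq_fin v, h, vecSeq_fin]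

end Seq

section Norms

variable {n : ℕ}

lemma norm_toLp_sq (v : Fin n → ℂ) : ‖WithLp.toLp 2 v‖ ^ 2 = ∑ i, ‖v i‖ ^ 2 :=
  PiLp.norm_sq_eq_of_L2 _ _

lemma frobenius_norm_sq (M : Matrix (Fin n) (Fin n) ℂ) : ‖M‖ ^ 2 = ∑ i, ∑ k, ‖M i k‖ ^ 2 := by
  rw [Matrix.frobenius_norm_def, ← Real.sqrt_eq_rpow, Real.sq_sqrt (by positivity)]
  norm_cast

lemma norm_toLp_mulVec_unitary {U : Matrix (Fin n) (Fin n) ℂ}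
    (hU : U ∈ Matrix.unitaryGroup (Fin n) ℂ) (v : Fin n → ℂ) :
    ‖WithLp.toLp 2 (U *ᵥ v)‖ = ‖WithLp.toLp 2 v‖ := by
  have h : ∀ w : Fin n → ℂ, ((‖WithLp.toLp 2 w‖ ^ 2 : ℝ) : ℂ) = star w ⬝ᵥ w := by
    intro w
    rw [norm_toLp_sq, dotProduct, Complex.ofReal_sum]
    refine Finset.sum_congr rfl fun i _ => ?_
    rw [Pi.star_apply, Complex.star_def, ← Complex.normSq_eq_conj_mul_self, Complex.sq_norm]
  have e : star (U *ᵥ v) ⬝ᵥ (U *ᵥ v) = star v ⬝ᵥ v := by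
    rw [Matrix.star_mulVec, Matrix.dotProduct_mulVec, Matrix.vecMul_vecMul,
      ← Matrix.star_eq_conjTranspose, Matrix.mem_unitaryGroup_iff'.mp hU, Matrix.vecMul_one]
  rw [← h, ← h] at e
  exact (sq_eq_sq₀ (norm_nonneg _) (norm_nonneg _)).mp (by exact_mod_cast e)

lemma frobenius_norm_unitary_mul {U : Matrix (Fin n) (Fin n) ℂ}
    (hU : U ∈ Matrix.unitaryGroup (Fin n) ℂ) (M : Matrix (Fin n) (Fin n) ℂ) :
    ‖U * M‖ = ‖M‖ := by
  have h : ∀ X : Matrix (Fin n) (Fin n) ℂ, ‖X‖ ^ 2 = ∑ k, ‖WithLp.toLp 2 fun i => X i k‖ ^ 2 := by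
    intro X
    rw [frobenius_norm_sq, Finset.sum_comm]
    simp_rw [norm_toLp_sq]
  refine (sq_eq_sq₀ (norm_nonneg _) (norm_nonneg _)).mp ?_
  rw [h, h]
  refine Finset.sum_congr rfl fun k _ => ?_
  rw [← norm_toLp_mulVec_unitary hU fun i => M i k]
  rfl

lemma frobenius_norm_mul_conjTranspose_unitary {U : Matrix (Fin n) (Fin n) ℂ}
    (hU : U ∈ Matrix.unitaryGroup (Fin n) ℂ) (M : Matrix (Fin n) (Fin n) ℂ) :
    ‖M * Uᴴ‖ = ‖M‖ := by
  rw [← Matrix.frobenius_norm_conjTranspose, Matrix.conjTranspose_mul,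
    Matrix.conjTranspose_conjTranspose, frobenius_norm_unitary_mul hU,
    Matrix.frobenius_norm_conjTranspose]

lemma norm_vecSeq_le (v : Fin n → ℂ) (i : ℕ) : ‖vecSeq v i‖ ≤ ‖WithLp.toLp 2 v‖ := by
  by_cases h : i < n
  · rw [vecSeq_of_lt v h]
    exact PiLp.norm_apply_le (WithLp.toLp 2 v) ⟨i, h⟩
  · simp [vecSeq, h]

lemma norm_matSeq_le (M : Matrix (Fin n) (Fin n) ℂ) (i k : ℕ) : ‖matSeq M i k‖ ≤ ‖M‖ := by
  by_cases h : i < n ∧ k < n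
  · rw [matSeq_of_lt M h.1 h.2]
    refine abs_le_of_sq_le_sq' ?_ (norm_nonneg _) |>.2
    rw [frobenius_norm_sq]
    refine le_trans ?_ (Finset.single_le_sum
      (f := fun i => ∑ k, ‖M i k‖ ^ 2) (fun _ _ => by positivity)
      (Finset.mem_univ (⟨i, h.1⟩ : Fin n)))
    exact Finset.single_le_sum (f := fun k => ‖M ⟨i, h.1⟩ k‖ ^ 2) (fun _ _ => by positivity)
      (Finset.mem_univ (⟨k, h.2⟩ : Fin n))
  · simp [matSeq, h]

lemma norm_toLp_le_of_forall {v : Fin n → ℂ} {b : ℝ} (hb : 0 ≤ b) (h : ∀ i, ‖v i‖ ≤ b) :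
    ‖WithLp.toLp 2 v‖ ≤ n * b := by
  refine abs_le_of_sq_le_sq' ?_ (by positivity) |>.2
  rw [norm_toLp_sq]
  calc ∑ i, ‖v i‖ ^ 2 ≤ ∑ _i : Fin n, b ^ 2 := by gcongr; exact h _
    _ = n * b ^ 2 := by simp
    _ ≤ (n * n : ℕ) * b ^ 2 := by gcongr; exact Nat.le_mul_self n
    _ = _ := by push_cast; ring

lemma frobenius_norm_le_of_forall {M : Matrix (Fin n) (Fin n) ℂ} {b : ℝ} (hb : 0 ≤ b)
    (h : ∀ i k, ‖M i k‖ ≤ b) : ‖M‖ ≤ n * b := by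
  refine abs_le_of_sq_le_sq' ?_ (by positivity) |>.2
  rw [frobenius_norm_sq]
  calc ∑ i, ∑ k, ‖M i k‖ ^ 2 ≤ ∑ _i : Fin n, ∑ _k : Fin n, b ^ 2 := by gcongr; exact h _ _
    _ = _ := by simp; ring

end Norms

/-! ### Givens rotations and their products -/

/-- The rotation with rows `(c, -s)` and `(s̄, c̄)` in the plane of the coordinates `j`, `j + 1`. -/
def givens (n j : ℕ) (c s : ℂ) : Matrix (Fin n) (Fin n) ℂ :=
  Matrix.of fun i k =>
    if (i : ℕ) = j then (if (k : ℕ) = j then c else if (k : ℕ) = j + 1 then -s else 0)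
    else if (i : ℕ) = j + 1 then
      (if (k : ℕ) = j then star s else if (k : ℕ) = j + 1 then star c else 0)
    else if i = k then 1 else 0

section Givens

variable {n j : ℕ}

lemma vecSeq_givens_mulVec (hj : j + 1 < n) (c s : ℂ) (v : Fin n → ℂ) (i : ℕ) :
    vecSeq (givens n j c s *ᵥ v) i =
      if i = j then c * vecSeq v j - s * vecSeq v (j + 1)
      else if i = j + 1 then star s * vecSeq v j + star c * vecSeq v (j + 1)
      else vecSeq v i := by
  by_cases hi : i < n
  swap
  · have h1 : i ≠ j := by omega
    have h2 : i ≠ j + 1 := by omega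
    simp [vecSeq, hi, h1, h2]
  have hj' : j < n := by omega
  have hne : (⟨j, hj'⟩ : Fin n) ≠ ⟨j + 1, hj⟩ := by simp
  have key : ∀ a b : ℂ, ∑ k : Fin n,
      (if (k : ℕ) = j then a else if (k : ℕ) = j + 1 then b else 0) * v k
        = a * vecSeq v j + b * vecSeq v (j + 1) := by
    intro a b
    rw [Fintype.sum_eq_add _ _ hne]
    · simp [vecSeq, hj, hj']
    · rintro k ⟨h1, h2⟩
      have h1' : (k : ℕ) ≠ j := fun h => h1 (Fin.ext h)
      have h2' : (k : ℕ) ≠ j + 1 := fun h => h2 (Fin.ext h)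
      simp [h1', h2']
  rw [vecSeq_of_lt _ hi]
  simp only [Matrix.mulVec, dotProduct, givens, Matrix.of_apply]
  split_ifs with h1 h2
  · rw [key]; ring
  · rw [key]
  · simp [vecSeq, hi]

lemma givens_conjTranspose (c s : ℂ) : (givens n j c s)ᴴ = givens n j (star c) (-s) := by
  ext i k
  simp only [givens, Matrix.conjTranspose_apply, Matrix.of_apply, Fin.ext_iff]
  split_ifs <;> first | omega | simp

lemma givens_mem_unitaryGroup (hj : j + 1 < n) {c s : ℂ} (h : ‖c‖ ^ 2 + ‖s‖ ^ 2 = 1) :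
    givens n j c s ∈ Matrix.unitaryGroup (Fin n) ℂ := by
  have h' : star c * c + star s * s = 1 := by
    have e1 : star c * c = ((‖c‖ ^ 2 : ℝ) : ℂ) := by
      rw [Complex.star_def, ← Complex.normSq_eq_conj_mul_self, Complex.sq_norm]
    have e2 : star s * s = ((‖s‖ ^ 2 : ℝ) : ℂ) := by
      rw [Complex.star_def, ← Complex.normSq_eq_conj_mul_self, Complex.sq_norm]
    rw [e1, e2, ← Complex.ofReal_add, h, Complex.ofReal_one]
  rw [Matrix.mem_unitaryGroup_iff', Matrix.star_eq_conjTranspose, givens_conjTranspose]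
  refine Matrix.mulVec_injective (funext fun v => vecSeq_injective (funext fun i => ?_))
  rw [← Matrix.mulVec_mulVec, vecSeq_givens_mulVec hj, vecSeq_givens_mulVec hj,
    vecSeq_givens_mulVec hj, vecSeq_givens_mulVec hj, Matrix.one_mulVec]
  simp only [if_true, Nat.succ_ne_self, if_false, star_star, star_neg]
  split_ifs with h1 h2
  · subst h1
    linear_combination (vecSeq v i) * h'
  · subst h2
    linear_combination (vecSeq v (j + 1)) * h'
  · rfl

lemma matSeq_givens_mul (hj : j + 1 < n) (c s : ℂ) (X : Matrix (Fin n) (Fin n) ℂ) (i k : ℕ) :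
    matSeq (givens n j c s * X) i k =
      if i = j then c * matSeq X j k - s * matSeq X (j + 1) k
      else if i = j + 1 then star s * matSeq X j k + star c * matSeq X (j + 1) k
      else matSeq X i k := by
  by_cases hk : k < n
  · have := vecSeq_givens_mulVec hj c s (fun r => X r ⟨k, hk⟩) i
    simp only [← matSeq_eq_vecSeq] at this
    rw [← this]
    exact matSeq_eq_vecSeq _ i ⟨k, hk⟩
  · simp [matSeq_of_not_lt _ _ hk]

lemma matSeq_mul_givens_conjTranspose (hj : j + 1 < n) (c s : ℂ)
    (Y : Matrix (Fin n) (Fin n) ℂ) (i k : ℕ) :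
    matSeq (Y * (givens n j c s)ᴴ) i k =
      if k = j then star c * matSeq Y i j - star s * matSeq Y i (j + 1)
      else if k = j + 1 then s * matSeq Y i j + c * matSeq Y i (j + 1)
      else matSeq Y i k := by
  have e : Y * (givens n j c s)ᴴ = (givens n j c s * Yᴴ)ᴴ := by
    rw [Matrix.conjTranspose_mul, Matrix.conjTranspose_conjTranspose]
  rw [e, matSeq_conjTranspose, matSeq_givens_mul hj]
  simp only [matSeq_conjTranspose]
  split_ifs <;> simp

end Givens

lemma norm_mul_sub_rotation_le' {u N e₁ e₂ e k : ℝ} {c s w x y z X Y : ℂ} (hu : 0 ≤ u) (hk : 0 ≤ k)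
    (hc : ‖c‖ ≤ 1) (hs : ‖s‖ ≤ 1)
    (hw : ‖w - (star s * x + star c * y)‖ ≤ k * u * (‖x‖ + ‖y‖))
    (hx : ‖x * z - X‖ ≤ e₁) (hy : ‖y * z - Y‖ ≤ e₂) (hX : ‖X‖ ≤ N) (hY : ‖Y‖ ≤ N)
    (hN : e₁ + e₂ ≤ 3 * N) (he : e₁ + e₂ + 5 * k * u * N ≤ e) :
    ‖w * z - (star s * X + star c * Y)‖ ≤ e := by
  have := norm_mul_sub_rotation_le (c := star s) (s := -star c) hu hk (by simpa) (by simpa)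
    (by simpa using hw) hx hy hX hY hN he
  simpa using this

/-- The products `W m` of exact rotations in the planes `(m, m + 1), …, (n - 2, n - 1)`, each of
which is close to the corresponding matrix `Q j`. -/
structure RotationChain {n : ℕ} (u : ℝ) (m : ℕ) (Q : ℕ → Matrix (Fin 2) (Fin 2) ℂ)
    (W : ℕ → Matrix (Fin n) (Fin n) ℂ) : Prop where
  mem : ∀ j, W j ∈ Matrix.unitaryGroup (Fin n) ℂ
  last : W (n - 1) = 1
  step : ∀ j, m ≤ j → j + 1 < n →
    ∃ c s, IsNearRotation u (Q j) c s ∧ W j = givens n j c s * W (j + 1)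

namespace RotationChain

variable {n : ℕ} {u : ℝ} {m : ℕ} {Q : ℕ → Matrix (Fin 2) (Fin 2) ℂ}
  {W : ℕ → Matrix (Fin n) (Fin n) ℂ}

/-- `W j` involves only the planes from `j` on. Hence the rows a pass has not reached are exactly
those of the input, which keeps the errors from doubling at each pass. -/
lemma vecSeq_mulVec (h : RotationChain u m Q W) {j : ℕ} (hj : m ≤ j) (hjn : j ≤ n - 1)
    (v : Fin n → ℂ) {i : ℕ} (hi : i < j) : vecSeq (W j *ᵥ v) i = vecSeq v i := by
  induction hjn using Nat.decreasingInduction with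
  | self => rw [h.last, Matrix.one_mulVec]
  | of_succ j hjn ih =>
    obtain ⟨c, s, -, e⟩ := h.step j hj (by omega)
    rw [e, ← Matrix.mulVec_mulVec, vecSeq_givens_mulVec (by omega), if_neg (by omega),
      if_neg (by omega)]
    exact ih (by omega) (by omega)

lemma matSeq_mul (h : RotationChain u m Q W) {j : ℕ} (hj : m ≤ j) (hjn : j ≤ n - 1)
    (X : Matrix (Fin n) (Fin n) ℂ) {i : ℕ} (hi : i < j) (k : ℕ) :
    matSeq (W j * X) i k = matSeq X i k := by
  by_cases hk : k < n
  · have := h.vecSeq_mulVec hj hjn (fun r => X r ⟨k, hk⟩) hi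
    rw [← matSeq_eq_vecSeq] at this
    exact (matSeq_eq_vecSeq _ i ⟨k, hk⟩).trans this
  · simp [matSeq_of_not_lt _ _ hk]

lemma matSeq_mul_conjTranspose (h : RotationChain u m Q W) {j : ℕ} (hj : m ≤ j)
    (hjn : j ≤ n - 1) (Y : Matrix (Fin n) (Fin n) ℂ) (i : ℕ) {k : ℕ} (hk : k < j) :
    matSeq (Y * (W j)ᴴ) i k = matSeq Y i k := by
  have e : Y * (W j)ᴴ = (W j * Yᴴ)ᴴ := by
    rw [Matrix.conjTranspose_mul, Matrix.conjTranspose_conjTranspose]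
  rw [e, matSeq_conjTranspose, h.matSeq_mul hj hjn _ hk, matSeq_conjTranspose, star_star]

/-- Extend a chain by one rotation. -/
lemma update (h : RotationChain u (m + 1) Q W) (hm : m + 1 < n) {R : Matrix (Fin 2) (Fin 2) ℂ}
    {c s : ℂ} (hR : IsNearRotation u R c s) :
    RotationChain u m (Function.update Q m R)
      (Function.update W m (givens n m c s * W (m + 1))) where
  mem j := by
    by_cases hj : j = m
    · subst hj
      rw [Function.update_self]
      exact mul_mem (givens_mem_unitaryGroup hm hR.unit) (h.mem _)
    · rw [Function.update_of_ne hj]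
      exact h.mem j
  last := by
    rw [Function.update_of_ne (by omega), h.last]
  step j hj hjn := by
    by_cases hjm : j = m
    · subst hjm
      exact ⟨c, s, by rwa [Function.update_self], by
        rw [Function.update_self, Function.update_of_ne (by omega)]⟩
    · rw [Function.update_of_ne hjm, Function.update_of_ne hjm, Function.update_of_ne (by omega)]
      exact h.step j (by omega) hjn

end RotationChain

/-! ### Error analysis of the elimination -/

namespace FloatArith

variable {u : ℝ} (F : FloatArith u)

/-- The rotation computed by an elimination step. -/
noncomputable def stepRotation (q : ℕ → ℂ) (j : ℕ) (s : ElimState) : Matrix (Fin 2) (Fin 2) ℂ :=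
  F.rotation
    (F.cplx.add (s.β j) (F.cplx.mul (s.p j) (star (q (j + 1)))))
    (F.cplx.add (s.d (j + 1)) (F.cplx.mul (s.p (j + 1)) (star (q (j + 1)))))

section Step

variable (q : ℕ → ℂ) (j : ℕ) (s : ElimState)

/-- The entry of `d` or `γ` read after an update is never the one just overwritten, so a pass has a
closed form in the old state. The case `j = 0` is separate because there `j - 1 = j`. -/
lemma elimStep_d (i : ℕ) : (F.elimStep q j s).d i =
    if i = j + 1 then F.apply₂ (F.stepRotation q j s) (s.β j) (s.d (j + 1))
    else if i = j then F.apply₁ (F.stepRotation q j s) (s.d j) (s.γ j) else s.d i := by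
  by_cases hj : j = 0
  · simp only [elimStep, stepRotation, Function.update_apply, hj, if_true]
    simp
  · have : j ≠ j - 1 := by omega
    simp only [elimStep, stepRotation, Function.update_apply, hj, if_false, this]
    simp

lemma elimStep_γ (i : ℕ) : (F.elimStep q j s).γ i =
    if i = j then F.apply₂ (F.stepRotation q j s) (s.d j) (s.γ j)
    else if i + 1 = j then F.apply₁ (F.stepRotation q j s) (s.γ i)
      (-F.cplx.mul (s.qt (j + 1)) (star (s.p i))) else s.γ i := by
  by_cases hj : j = 0
  · simp only [elimStep, stepRotation, Function.update_apply, hj, if_true]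
    simp
  · have h1 : j ≠ j - 1 := by omega
    have h2 : i = j - 1 ↔ i + 1 = j := by omega
    simp only [elimStep, stepRotation, Function.update_apply, hj, if_false, h1]
    by_cases h3 : i + 1 = j
    · simp [← h3]
    · simp [h2, h3]

lemma elimStep_β_of_ne {i : ℕ} (h : i ≠ j) : (F.elimStep q j s).β i = s.β i :=
  Function.update_of_ne h _ _

lemma rotateAt_self (Q : Matrix (Fin 2) (Fin 2) ℂ) (v : ℕ → ℂ) :
    F.rotateAt Q j v j = F.apply₁ Q (v j) (v (j + 1)) := by
  simp [rotateAt]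

lemma rotateAt_succ (Q : Matrix (Fin 2) (Fin 2) ℂ) (v : ℕ → ℂ) :
    F.rotateAt Q j v (j + 1) = F.apply₂ Q (v j) (v (j + 1)) := by
  simp [rotateAt]

lemma rotateAt_of_ne (Q : Matrix (Fin 2) (Fin 2) ℂ) (v : ℕ → ℂ) {i : ℕ} (h : i ≠ j)
    (h' : i ≠ j + 1) : F.rotateAt Q j v i = v i := by
  simp [rotateAt, h, h']

lemma elimStep_p_of_ne {i : ℕ} (h : i ≠ j) (h' : i ≠ j + 1) :
    (F.elimStep q j s).p i = s.p i := by
  simp only [elimStep]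
  rw [ite_apply, Function.update_of_ne h, ite_self, rotateAt_of_ne _ _ _ _ h h']

lemma elimStep_p_succ : (F.elimStep q j s).p (j + 1) =
    F.apply₂ (F.stepRotation q j s) (s.p j) (s.p (j + 1)) := by
  simp only [elimStep]
  have h : j + 1 ≠ j := by omega
  rw [ite_apply]
  simp only [Function.update_of_ne h, rotateAt_succ, ite_self, stepRotation]

lemma elimStep_p_self : (F.elimStep q j s).p j =
    if F.normSq₂
        (F.cplx.mul (F.apply₁ (F.stepRotation q j s) (s.p j) (s.p (j + 1))) (star (q (j + 1))))
        (F.cplx.mul (F.apply₂ (F.stepRotation q j s) (s.p j) (s.p (j + 1))) (star (q (j + 1))))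
        > F.normSq₂ (F.apply₁ (F.stepRotation q j s) (s.β j) (s.d (j + 1)))
          (F.apply₂ (F.stepRotation q j s) (s.β j) (s.d (j + 1))) then
      -F.cplx.div (F.apply₁ (F.stepRotation q j s) (s.β j) (s.d (j + 1))) (star (q (j + 1)))
    else F.apply₁ (F.stepRotation q j s) (s.p j) (s.p (j + 1)) := by
  simp only [elimStep]
  have h : j + 1 ≠ j := by omega
  rw [ite_apply]
  simp only [Function.update_self, Function.update_of_ne h, rotateAt_self, rotateAt_succ,
    stepRotation]
  congr

lemma elimStep_qt_of_lt {i : ℕ} (h : i < j) : (F.elimStep q j s).qt i = s.qt i :=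
  F.rotateAt_of_ne _ _ _ (by omega) (by omega)

lemma elimStep_qt_self : (F.elimStep q j s).qt j =
    F.apply₁ (F.stepRotation q j s) (s.qt j) (s.qt (j + 1)) :=
  F.rotateAt_self _ _ _

end Step

end FloatArith

section Generators

variable {n : ℕ} {A : Matrix (Fin n) (Fin n) ℂ} {p q : Fin n → ℂ}

lemma diagSeq_eq_matSeq (A : Matrix (Fin n) (Fin n) ℂ) (i : ℕ) : diagSeq A i = matSeq A i i := by
  by_cases h : i < n <;> simp [diagSeq, matSeq, h]

lemma superdiagSeq_eq_matSeq (A : Matrix (Fin n) (Fin n) ℂ) (i : ℕ) :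
    superdiagSeq A i = matSeq A i (i + 1) := by
  by_cases h : i + 1 < n
  · simp [superdiagSeq, matSeq, h, Nat.lt_of_succ_lt h]
  · simp [superdiagSeq, matSeq, h]

/-- The sign sits on the factor `q`, to fit the form `x * z ≈ X` of `norm_mul_sub_rotation_le`. -/
lemma IsLowerHessenberg.matSeq_upper
    (h : IsLowerHessenberg (A + Matrix.vecMulVec p (star q))) {i k : ℕ} (hik : i + 1 < k)
    (hk : k < n) : vecSeq p i * -star (vecSeq q k) = matSeq A i k := by
  have hi : i < n := by omega
  have := h ⟨i, hi⟩ ⟨k, hk⟩ hik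
  rw [Matrix.add_apply, Matrix.vecMulVec_apply, Pi.star_apply] at this
  rw [matSeq_of_lt A hi hk, vecSeq_of_lt p hi, vecSeq_of_lt q hk]
  linear_combination -this

lemma Matrix.IsHermitian.star_matSeq (hA : A.IsHermitian) (i k : ℕ) :
    star (matSeq A i k) = matSeq A k i := by
  rw [← matSeq_conjTranspose, hA.eq]

lemma IsLowerHessenberg.matSeq_lower (hA : A.IsHermitian)
    (h : IsLowerHessenberg (A + Matrix.vecMulVec p (star q))) {i k : ℕ} (hik : k + 1 < i)
    (hi : i < n) : vecSeq q i * -star (vecSeq p k) = matSeq A i k := by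
  rw [← hA.star_matSeq, ← h.matSeq_upper hik hi]
  simp [mul_comm]

end Generators

/-- The state of the elimination before the pass that rotates the rows `m - 1` and `m`: the rows
before `m` are the original ones, and the remaining ones represent the matrix `W m * A` and the
vector `W m *ᵥ p` with entrywise errors `E` and `E'`. -/
structure ElimInvariant {n : ℕ} (A : Matrix (Fin n) (Fin n) ℂ) (p q : Fin n → ℂ) (m : ℕ)
    (W : ℕ → Matrix (Fin n) (Fin n) ℂ) (s : ElimState) (u E E' : ℝ) : Prop where
  chain : RotationChain u m s.Q W
  d_lt : ∀ i < m, s.d i = matSeq A i i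
  β_lt : ∀ i < m, s.β i = matSeq A i (i + 1)
  γ_lt : ∀ i, i + 1 < m → s.γ i = matSeq A (i + 1) i
  p_lt : ∀ i < m, s.p i = vecSeq p i
  qt_lt : ∀ i < m, s.qt i = vecSeq q i
  d_ge : ∀ i, m ≤ i → i < n → ‖s.d i - matSeq (W m * A) i i‖ ≤ E
  γ_ge : ∀ i, m ≤ i + 1 → i + 1 < n → ‖s.γ i - matSeq (W m * A) (i + 1) i‖ ≤ E
  p_ge : ∀ i k, m ≤ i → i < k → k < n →
    ‖s.p i * -star (vecSeq q k) - matSeq (W m * A) i k‖ ≤ E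
  qt_self : ∀ k, k + 1 < m → ‖s.qt m * -star (vecSeq p k) - matSeq (W m * A) m k‖ ≤ E
  p_err : ∀ i, m ≤ i → i < n → ‖s.p i - vecSeq (W m *ᵥ p) i‖ ≤ E'

namespace FloatArith

variable {u : ℝ} (F : FloatArith u) {n : ℕ} {A : Matrix (Fin n) (Fin n) ℂ} {p q : Fin n → ℂ}

/-- The state at the start of the elimination. -/
def initState (d β p q : ℕ → ℂ) : ElimState :=
  { d := d, β := β, γ := fun i => star (β i), p := p, qt := q, Q := fun _ => 1 }

lemma elimInvariant_init (hA : A.IsHermitian)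
    (hH : IsLowerHessenberg (A + Matrix.vecMulVec p (star q))) :
    ElimInvariant A p q (n - 1) (fun _ => 1)
      (initState (diagSeq A) (superdiagSeq A) (vecSeq p) (vecSeq q)) u 0 0 where
  chain := ⟨fun _ => one_mem _, rfl, fun j h h' => by omega⟩
  d_lt i _ := diagSeq_eq_matSeq A i
  β_lt i _ := superdiagSeq_eq_matSeq A i
  γ_lt i _ := by
    simp only [initState, superdiagSeq_eq_matSeq]
    exact hA.star_matSeq _ _
  p_lt i _ := rfl
  qt_lt i _ := rfl
  d_ge i _ _ := by simp [initState, diagSeq_eq_matSeq]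
  γ_ge i _ _ := by
    simp only [initState, superdiagSeq_eq_matSeq]
    rw [hA.star_matSeq, Matrix.one_mul, sub_self, norm_zero]
  p_ge i k _ _ _ := by omega
  qt_self k hk := by
    simp only [initState]
    rw [hH.matSeq_lower hA hk (by omega), Matrix.one_mul, sub_self, norm_zero]
  p_err i _ _ := by simp [initState]

/-- For an entry that is not stored but formed as a product when a pass needs it. The product has
modulus at most `E + N ≤ 2 * N`. -/
lemma norm_neg_mul_sub_le (hu : 0 ≤ u) {x y X : ℂ} {E N : ℝ} (h : ‖x * -y - X‖ ≤ E)
    (hX : ‖X‖ ≤ N) (hE : E ≤ N) : ‖-F.cplx.mul x y - X‖ ≤ E + 2 * (u * N) := by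
  have e := F.cplx.norm_mul_sub_le x y
  have e1 := norm_le_norm_add_norm_sub' (x * -y) X
  have e2 : ‖x * y‖ ≤ 2 * N := by
    rw [mul_neg, norm_neg] at e1
    rw [mul_neg] at h
    linarith
  calc _ = ‖(x * -y - X) - (F.cplx.mul x y - x * y)‖ := by congr 1; ring
    _ ≤ E + u * (2 * N) := (norm_sub_le _ _).trans (add_le_add h (e.trans (by gcongr)))
    _ = _ := by ring

/-- Row `m` is still exact, so every rotation has `e₁ = 0` and the old error is carried over once.
The increment `10 ^ 4` is `5 * 2000`, set by the corrected entry of `p`; the other rotations cost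
about 50. -/
lemma ElimInvariant.step {m : ℕ} {W : ℕ → Matrix (Fin n) (Fin n) ℂ} {s : ElimState} {E E' : ℝ}
    (hu : 0 ≤ u) (hu' : u ≤ 1 / 1000) (hA : A.IsHermitian)
    (hH : IsLowerHessenberg (A + Matrix.vecMulVec p (star q))) (hm : m + 1 < n)
    (h : ElimInvariant A p q (m + 1) W s u E E') (hE0 : 0 ≤ E) (hE : E ≤ ‖A‖)
    (hE'0 : 0 ≤ E') (hE' : E' ≤ ‖WithLp.toLp 2 p‖) :
    ∃ W', ElimInvariant A p q m W' (F.elimStep (vecSeq q) m s) u (E + 10 ^ 4 * u * ‖A‖)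
      (E' + 10 ^ 4 * u * ‖WithLp.toLp 2 p‖) := by
  obtain ⟨c, t, hR, hcor, hres⟩ := F.exists_isNearRotation_correction hu hu' (s.β m) (s.d (m + 1))
    (s.p m) (s.p (m + 1)) (star (vecSeq q (m + 1))) (Q := F.stepRotation (vecSeq q) m s) rfl
    (F.elimStep_p_self (vecSeq q) m s)
  set R := F.stepRotation (vecSeq q) m s with hRdef
  have hc := hR.norm_c_le
  have ht := hR.norm_s_le
  set N := ‖A‖ with hNdef
  have hN0 : 0 ≤ N := norm_nonneg _
  set N' := ‖WithLp.toLp 2 p‖ with hN'def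
  have hN'0 : 0 ≤ N' := norm_nonneg _
  have huN : 0 ≤ u * N := mul_nonneg hu hN0
  have huN' : u * N ≤ 1 / 1000 * N := by gcongr
  have huNp : 0 ≤ u * N' := mul_nonneg hu hN'0
  have huE : u * E ≤ u * N := by gcongr
  have hX : ∀ i k, ‖matSeq (W (m + 1) * A) i k‖ ≤ N := fun i k => by
    refine (norm_matSeq_le _ i k).trans_eq ?_
    rw [frobenius_norm_unitary_mul (h.chain.mem _)]
  have hAN : ∀ i k, ‖matSeq A i k‖ ≤ N := norm_matSeq_le A
  have hXp : ∀ i, ‖vecSeq (W (m + 1) *ᵥ p) i‖ ≤ N' := fun i => by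
    refine (norm_vecSeq_le _ i).trans_eq ?_
    rw [norm_toLp_mulVec_unitary (h.chain.mem _)]
  have hpN : ∀ i, ‖vecSeq p i‖ ≤ N' := norm_vecSeq_le p
  have hchain := h.chain.update hm hR
  set W' := Function.update W m (givens n m c t * W (m + 1)) with hW'
  have hWm : W' m = givens n m c t * W (m + 1) := Function.update_self _ _ _
  have hlow : ∀ i k, i ≤ m → matSeq (W (m + 1) * A) i k = matSeq A i k := fun i k hi =>
    h.chain.matSeq_mul le_rfl (by omega) A (by omega) k
  have hX₁ : ∀ k, matSeq (W' m * A) m k =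
      c * matSeq A m k - t * matSeq (W (m + 1) * A) (m + 1) k := fun k => by
    rw [hWm, Matrix.mul_assoc, matSeq_givens_mul hm, if_pos rfl, hlow m k le_rfl]
  have hX₂ : ∀ k, matSeq (W' m * A) (m + 1) k =
      star t * matSeq A m k + star c * matSeq (W (m + 1) * A) (m + 1) k := fun k => by
    rw [hWm, Matrix.mul_assoc, matSeq_givens_mul hm, if_neg (by omega), if_pos rfl,
      hlow m k le_rfl]
  have hX₃ : ∀ i k, m + 1 < i → matSeq (W' m * A) i k = matSeq (W (m + 1) * A) i k :=
    fun i k hi => by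
      rw [hWm, Matrix.mul_assoc, matSeq_givens_mul hm, if_neg (by omega), if_neg (by omega)]
  have hp₁ : vecSeq (W' m *ᵥ p) m = c * vecSeq p m - t * vecSeq (W (m + 1) *ᵥ p) (m + 1) := by
    rw [hWm, ← Matrix.mulVec_mulVec, vecSeq_givens_mulVec hm, if_pos rfl,
      h.chain.vecSeq_mulVec le_rfl (by omega) p (Nat.lt_succ_self m)]
  have hp₂ : vecSeq (W' m *ᵥ p) (m + 1) =
      star t * vecSeq p m + star c * vecSeq (W (m + 1) *ᵥ p) (m + 1) := by
    rw [hWm, ← Matrix.mulVec_mulVec, vecSeq_givens_mulVec hm, if_neg (by omega), if_pos rfl,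
      h.chain.vecSeq_mulVec le_rfl (by omega) p (Nat.lt_succ_self m)]
  have hp₃ : ∀ i, m + 1 < i → vecSeq (W' m *ᵥ p) i = vecSeq (W (m + 1) *ᵥ p) i :=
    fun i hi => by
      rw [hWm, ← Matrix.mulVec_mulVec, vecSeq_givens_mulVec hm, if_neg (by omega),
        if_neg (by omega)]
  -- the pairs of entries that are rotated
  have hdm := h.d_lt m m.lt_succ_self
  have hβm := h.β_lt m m.lt_succ_self
  have hpm := h.p_lt m m.lt_succ_self
  have hqm := h.qt_lt m m.lt_succ_self
  have hd := h.d_ge (m + 1) le_rfl hm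
  have hγ := h.γ_ge m le_rfl hm
  -- Kept at 50 = 5 · 10, since this entry is later compared with `-p q*`, at the further cost of
  -- the residual.
  have hβ₁ : ‖F.apply₁ R (s.β m) (s.d (m + 1)) * 1 - matSeq (W' m * A) m (m + 1)‖
      ≤ E + 50 * (u * N) := by
    rw [hX₁]
    refine norm_mul_sub_rotation_le (N := N) (e₁ := 0) (e₂ := E) hu (by norm_num) hc ht
      (F.norm_apply₁_sub_le hu hu' hR _ _) ?_ ?_ (hAN _ _) (hX _ _) (by linarith) (by linarith)
    · simp [hβm]
    · simpa using hd
  have hβ₂ : ‖F.apply₂ R (s.β m) (s.d (m + 1)) * 1 - matSeq (W' m * A) (m + 1) (m + 1)‖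
      ≤ E + 10 ^ 4 * u * N := by
    rw [hX₂]
    refine norm_mul_sub_rotation_le' (N := N) (e₁ := 0) (e₂ := E) hu (by norm_num) hc ht
      (F.norm_apply₂_sub_le hu hu' hR _ _) ?_ ?_ (hAN _ _) (hX _ _) (by linarith) (by linarith)
    · simp [hβm]
    · simpa using hd
  have hd₁ : ‖F.apply₁ R (s.d m) (s.γ m) * 1 - matSeq (W' m * A) m m‖
      ≤ E + 10 ^ 4 * u * N := by
    rw [hX₁]
    refine norm_mul_sub_rotation_le (N := N) (e₁ := 0) (e₂ := E) hu (by norm_num) hc ht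
      (F.norm_apply₁_sub_le hu hu' hR _ _) ?_ ?_ (hAN _ _) (hX _ _) (by linarith) (by linarith)
    · simp [hdm]
    · simpa using hγ
  have hd₂ : ‖F.apply₂ R (s.d m) (s.γ m) * 1 - matSeq (W' m * A) (m + 1) m‖
      ≤ E + 10 ^ 4 * u * N := by
    rw [hX₂]
    refine norm_mul_sub_rotation_le' (N := N) (e₁ := 0) (e₂ := E) hu (by norm_num) hc ht
      (F.norm_apply₂_sub_le hu hu' hR _ _) ?_ ?_ (hAN _ _) (hX _ _) (by linarith) (by linarith)
    · simp [hdm]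
    · simpa using hγ
  -- The entry of row `m + 1` two places left of the diagonal is not stored; `q̃` serves to recover
  -- it as `-q̃ p*`.
  have hγ₁ : ∀ i, i + 1 = m →
      ‖F.apply₁ R (s.γ i) (-F.cplx.mul (s.qt (m + 1)) (star (s.p i))) * 1
        - matSeq (W' m * A) m i‖ ≤ E + 10 ^ 4 * u * N := by
    intro i hi
    have hq := h.qt_self i (by omega)
    have hpi := h.p_lt i (by omega)
    rw [hX₁]
    refine norm_mul_sub_rotation_le (N := N) (e₁ := 0) (e₂ := E + 2 * (u * N)) hu (by norm_num)
      hc ht (F.norm_apply₁_sub_le hu hu' hR _ _) ?_ ?_ (hAN _ _) (hX _ _) (by linarith)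
      (by linarith)
    · rw [h.γ_lt i (by omega), hi, mul_one, sub_self, norm_zero]
    · rw [mul_one, hpi]
      exact F.norm_neg_mul_sub_le hu hq (hX _ _) hE
  have hpA : ∀ k, m + 1 < k → k < n →
      ‖s.p m * -star (vecSeq q k) - matSeq A m k‖ ≤ 0 := fun k hk hkn => by
    rw [hpm, hH.matSeq_upper hk hkn, sub_self, norm_zero]
  refine ⟨W', hchain, ?_, ?_, ?_, ?_, ?_, ?_, ?_, ?_, ?_, ?_⟩
  · intro i hi
    rw [elimStep_d, if_neg (by omega), if_neg (by omega)]
    exact h.d_lt i (by omega)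
  · intro i hi
    rw [elimStep_β_of_ne _ _ _ _ (by omega)]
    exact h.β_lt i (by omega)
  · intro i hi
    rw [elimStep_γ, if_neg (by omega), if_neg (by omega)]
    exact h.γ_lt i (by omega)
  · intro i hi
    rw [elimStep_p_of_ne _ _ _ _ (by omega) (by omega)]
    exact h.p_lt i (by omega)
  · intro i hi
    rw [elimStep_qt_of_lt _ _ _ _ hi]
    exact h.qt_lt i (by omega)
  · intro i hi hin
    rw [elimStep_d]
    split_ifs with h1 h2
    · subst h1
      simpa using hβ₂
    · subst h2
      simpa using hd₁
    · rw [hX₃ i i (by omega)]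
      linarith [h.d_ge i (by omega) hin]
  · intro i hi hin
    rw [elimStep_γ]
    split_ifs with h1 h2
    · subst h1
      simpa using hd₂
    · have := hγ₁ i h2
      rw [h2]
      simpa using this
    · rw [hX₃ (i + 1) i (by omega)]
      linarith [h.γ_ge i (by omega) hin]
  · intro i k hi hik hk
    by_cases h1 : i = m
    · subst h1
      by_cases h2 : k = i + 1
      -- The eliminated entry: the old products say nothing about it, so it is reached through the
      -- rotated `β`, at cost 50 + 2000 · 3 ≤ 10 ^ 4.
      · subst h2
        have e1 : ‖s.β i‖ ≤ N := by rw [hβm]; exact hAN _ _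
        have e2 : ‖s.d (i + 1)‖ ≤ N + E := by
          have := norm_le_norm_add_norm_sub' (s.d (i + 1)) (matSeq (W (i + 1) * A) (i + 1) (i + 1))
          linarith [hX (i + 1) (i + 1)]
        have e3 : 2000 * u * (‖s.β i‖ + ‖s.d (i + 1)‖) ≤ 2000 * u * (3 * N) := by
          gcongr
          linarith
        rw [mul_one] at hβ₁
        calc _ = ‖(F.apply₁ R (s.β i) (s.d (i + 1)) - matSeq (W' i * A) i (i + 1))
              - (F.apply₁ R (s.β i) (s.d (i + 1)) + (F.elimStep (vecSeq q) i s).p i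
                * star (vecSeq q (i + 1)))‖ := by congr 1; ring
          _ ≤ _ := (norm_sub_le _ _).trans (add_le_add hβ₁ (hres.trans e3))
          _ ≤ _ := by linarith
      · rw [hX₁]
        exact norm_mul_sub_rotation_le (N := N) (e₁ := 0) (e₂ := E) hu (by norm_num) hc ht hcor
          (hpA k (by omega) hk) (h.p_ge (i + 1) k le_rfl (by omega) hk) (hAN _ _) (hX _ _)
          (by linarith) (by linarith)
    · by_cases h2 : i = m + 1
      · subst h2
        rw [hX₂, elimStep_p_succ]
        exact norm_mul_sub_rotation_le' (N := N) (e₁ := 0) (e₂ := E) hu (by norm_num) hc ht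
          (F.norm_apply₂_sub_le hu hu' hR _ _)
          (hpA k (by omega) hk) (h.p_ge (m + 1) k le_rfl (by omega) hk) (hAN _ _) (hX _ _)
          (by linarith) (by linarith)
      · rw [hX₃ i k (by omega), elimStep_p_of_ne _ _ _ _ h1 h2]
        linarith [h.p_ge i k (by omega) hik hk]
  · intro k hk
    rw [hX₁, elimStep_qt_self]
    refine norm_mul_sub_rotation_le (N := N) (e₁ := 0) (e₂ := E) hu (by norm_num) hc ht
      (F.norm_apply₁_sub_le hu hu' hR _ _) ?_ (h.qt_self k (by omega)) (hAN _ _) (hX _ _)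
      (by linarith) (by linarith)
    rw [hqm, hH.matSeq_lower hA hk (by omega), sub_self, norm_zero]
  · intro i hi hin
    by_cases h1 : i = m
    · subst h1
      rw [hp₁, ← mul_one ((F.elimStep (vecSeq q) i s).p i)]
      refine norm_mul_sub_rotation_le (N := N') (e₁ := 0) (e₂ := E') hu (by norm_num) hc ht hcor
        ?_ ?_ (hpN _) (hXp _) (by linarith) (by linarith)
      · simp [hpm]
      · simpa using h.p_err (i + 1) le_rfl hm
    · by_cases h2 : i = m + 1
      · subst h2
        rw [hp₂, elimStep_p_succ, ← mul_one (F.apply₂ _ _ _)]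
        refine norm_mul_sub_rotation_le' (N := N') (e₁ := 0) (e₂ := E') hu (by norm_num) hc ht
          (F.norm_apply₂_sub_le hu hu' hR _ _) ?_ ?_ (hpN _) (hXp _) (by linarith) (by linarith)
        · simp [hpm]
        · simpa using h.p_err (m + 1) le_rfl hm
      · rw [hp₃ i (by omega), elimStep_p_of_ne _ _ _ _ h1 h2]
        linarith [h.p_err i (by omega) hin]

/-- The real `k` counts the passes already made; the smallness condition keeps the errors below
`‖A‖` and `‖p‖`, as each pass requires. -/
lemma ElimInvariant.loop (hu : 0 ≤ u) (hu' : u ≤ 1 / 1000) (hA : A.IsHermitian)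
    (hH : IsLowerHessenberg (A + Matrix.vecMulVec p (star q))) (m : ℕ) :
    ∀ {W : ℕ → Matrix (Fin n) (Fin n) ℂ} {s : ElimState} {k : ℝ}, m ≤ n - 1 → 0 ≤ k →
      10 ^ 4 * (k + m) * u ≤ 1 →
      ElimInvariant A p q m W s u (10 ^ 4 * k * u * ‖A‖) (10 ^ 4 * k * u * ‖WithLp.toLp 2 p‖) →
      ∃ W', ElimInvariant A p q 0 W' (F.elimLoop (vecSeq q) m s) u
        (10 ^ 4 * (k + m) * u * ‖A‖) (10 ^ 4 * (k + m) * u * ‖WithLp.toLp 2 p‖) := by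
  induction m with
  | zero =>
    intro W s k _ _ _ h
    exact ⟨W, by simpa [elimLoop] using h⟩
  | succ m ih =>
    intro W s k hm hk hku h
    push_cast at hku
    have hmu : 0 ≤ (m : ℝ) * u := by positivity
    have hk1 : 10 ^ 4 * k * u ≤ 1 := by linarith
    obtain ⟨W₁, h₁⟩ := ElimInvariant.step F hu hu' hA hH (by omega) h (by positivity)
      (mul_le_of_le_one_left (norm_nonneg _) hk1) (by positivity)
      (mul_le_of_le_one_left (norm_nonneg _) hk1)
    have e : ∀ x : ℝ, 10 ^ 4 * k * u * x + 10 ^ 4 * u * x = 10 ^ 4 * (k + 1) * u * x :=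
      fun x => by ring
    rw [e, e] at h₁
    obtain ⟨W₂, h₂⟩ := ih (by omega) (by positivity) (by linarith) h₁
    refine ⟨W₂, ?_⟩
    have e' : k + ((m + 1 : ℕ) : ℝ) = k + 1 + m := by push_cast; ring
    rw [e']
    exact h₂

/-- The elimination computes the generators of the rotated matrix with small entrywise errors. -/
lemma exists_elimInvariant_qrElim (hu : 0 ≤ u) (hu' : u ≤ 1 / 1000) (hnu : 10 ^ 4 * n * u ≤ 1)
    (hA : A.IsHermitian) (hH : IsLowerHessenberg (A + Matrix.vecMulVec p (star q))) :
    ∃ W, ElimInvariant A p q 0 W (F.qrElim A p q) u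
      (10 ^ 4 * (n - 1 : ℕ) * u * ‖A‖) (10 ^ 4 * (n - 1 : ℕ) * u * ‖WithLp.toLp 2 p‖) := by
  have hn : ((n - 1 : ℕ) : ℝ) ≤ n := by exact_mod_cast Nat.sub_le n 1
  have := ElimInvariant.loop F hu hu' hA hH (n - 1) (k := 0) le_rfl le_rfl
    (le_trans (by gcongr; linarith) hnu) (by simpa using elimInvariant_init hA hH)
  simp only [zero_add] at this
  exact this

end FloatArith

/-! ### Error analysis of the rotation back -/

/-- The state of the rotation back before the pass that rotates the columns `m - 1` and `m`: the
columns before `m` are those of `M`, which the elimination has computed as `d`, `p`, `q`, and the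
remaining ones represent the upper triangle of `M * (W m)ᴴ` and the vector `W m *ᵥ q` with
entrywise errors `e` and `e'`. -/
structure BackInvariant {n : ℕ} (M : Matrix (Fin n) (Fin n) ℂ) (d p : ℕ → ℂ) (q : Fin n → ℂ)
    (m : ℕ) (W : ℕ → Matrix (Fin n) (Fin n) ℂ) (s : BackState) (e e' : ℝ) : Prop where
  d_lt : ∀ i < m, s.d i = d i
  q_lt : ∀ i < m, s.q i = vecSeq q i
  d_ge : ∀ i, m ≤ i → i < n → ‖s.d i - matSeq (M * (W m)ᴴ) i i‖ ≤ e
  β_ge : ∀ i, m ≤ i → i + 1 < n → ‖s.β i - matSeq (M * (W m)ᴴ) i (i + 1)‖ ≤ e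
  p_ge : ∀ i k, m ≤ k → k < n → i + 1 < k ∨ i < m ∧ i < k →
    ‖p i * -star (s.q k) - matSeq (M * (W m)ᴴ) i k‖ ≤ e
  q_err : ∀ i, m ≤ i → i < n → ‖s.q i - vecSeq (W m *ᵥ q) i‖ ≤ e'

/-- Lets `q`, the vector now being rotated, be the first factor in the propagation lemmas. -/
lemma norm_mul_neg_star_sub (x y X : ℂ) : ‖x * -star y - X‖ = ‖y * -star x - star X‖ := by
  rw [← norm_star]
  congr 1
  simp [mul_comm]

namespace FloatArith

variable {u : ℝ} (F : FloatArith u)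

section Step

variable (Q : ℕ → Matrix (Fin 2) (Fin 2) ℂ) (γ p : ℕ → ℂ) (j : ℕ) (s : BackState)

lemma backStep_d (i : ℕ) : (F.backStep Q γ p j s).d i =
    if i = j + 1 then F.apply₂ ((Q j).map star) (γ j) (s.d (j + 1))
    else if i = j then
      F.apply₁ ((Q j).map star) (s.d j) (-F.cplx.mul (p j) (star (s.q (j + 1))))
    else s.d i := by
  have h : j + 1 ≠ j := by omega
  simp only [backStep, Function.update_apply, h, if_false]

lemma backStep_β (i : ℕ) : (F.backStep Q γ p j s).β i =
    if i = j then
      F.apply₂ ((Q j).map star) (s.d j) (-F.cplx.mul (p j) (star (s.q (j + 1))))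
    else s.β i := by
  simp only [backStep, Function.update_apply]

lemma backStep_q : (F.backStep Q γ p j s).q = F.rotateAt (Q j) j s.q := rfl

end Step

variable {n : ℕ} {M : Matrix (Fin n) (Fin n) ℂ} {d γ p : ℕ → ℂ} {q : Fin n → ℂ}
  {Q : ℕ → Matrix (Fin 2) (Fin 2) ℂ} {W : ℕ → Matrix (Fin n) (Fin n) ℂ} {E e e' : ℝ}

/-- Column `m` carries the elimination error `E` and column `m + 1` the accumulated `e`. Their sum
makes `e` grow by about `E` per pass, hence quadratically in `n` overall. Only existing products are
rotated, so no correction is needed. -/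
lemma BackInvariant.step {m : ℕ} {s : BackState} (hu : 0 ≤ u) (hu' : u ≤ 1 / 1000)
    (hW : RotationChain u 0 Q W) (hm : m + 1 < n)
    (hd : ∀ i < n, ‖d i - matSeq M i i‖ ≤ E)
    (hγ : ∀ i, i + 1 < n → ‖γ i - matSeq M (i + 1) i‖ ≤ E)
    (hp : ∀ i k, i < k → k < n → ‖p i * -star (vecSeq q k) - matSeq M i k‖ ≤ E)
    (h : BackInvariant M d p q (m + 1) W s e e') (hE0 : 0 ≤ E) (hE : E ≤ ‖M‖)
    (he : e ≤ ‖M‖) (he'0 : 0 ≤ e') (he' : e' ≤ ‖WithLp.toLp 2 q‖) :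
    BackInvariant M d p q m W (F.backStep Q γ p m s) (e + (E + 10 ^ 4 * u * ‖M‖))
      (e' + 10 ^ 4 * u * ‖WithLp.toLp 2 q‖) := by
  obtain ⟨c, t, hR, hWm⟩ := hW.step m (Nat.zero_le _) hm
  have hc := hR.norm_c_le
  have ht := hR.norm_s_le
  have hRs := hR.map_star
  have hcs := hRs.norm_c_le
  have hts := hRs.norm_s_le
  set N := ‖M‖ with hNdef
  have hN0 : 0 ≤ N := norm_nonneg _
  set N' := ‖WithLp.toLp 2 q‖ with hN'def
  have hN'0 : 0 ≤ N' := norm_nonneg _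
  have huN : 0 ≤ u * N := mul_nonneg hu hN0
  have huN' : u * N ≤ 1 / 1000 * N := by gcongr
  have huNq : 0 ≤ u * N' := mul_nonneg hu hN'0
  have hMN : ∀ i k, ‖matSeq M i k‖ ≤ N := norm_matSeq_le M
  have hY : ∀ i k, ‖matSeq (M * (W (m + 1))ᴴ) i k‖ ≤ N := fun i k => by
    refine (norm_matSeq_le _ i k).trans_eq ?_
    rw [frobenius_norm_mul_conjTranspose_unitary (hW.mem _)]
  have hqN : ∀ i, ‖vecSeq q i‖ ≤ N' := norm_vecSeq_le q
  have hYq : ∀ i, ‖vecSeq (W (m + 1) *ᵥ q) i‖ ≤ N' := fun i => by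
    refine (norm_vecSeq_le _ i).trans_eq ?_
    rw [norm_toLp_mulVec_unitary (hW.mem _)]
  have hlow : ∀ i k, k ≤ m → matSeq (M * (W (m + 1))ᴴ) i k = matSeq M i k := fun i k hk =>
    hW.matSeq_mul_conjTranspose (Nat.zero_le _) (by omega) M i (by omega)
  have hWm' : M * (W m)ᴴ = M * (W (m + 1))ᴴ * (givens n m c t)ᴴ := by
    rw [hWm, Matrix.conjTranspose_mul, Matrix.mul_assoc]
  have hY₁ : ∀ i, matSeq (M * (W m)ᴴ) i m =
      star c * matSeq M i m - star t * matSeq (M * (W (m + 1))ᴴ) i (m + 1) := fun i => by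
    rw [hWm', matSeq_mul_givens_conjTranspose hm, if_pos rfl, hlow i m le_rfl]
  -- The double stars put column `m + 1` in the form of a second row, for the conjugated parameters.
  have hY₂ : ∀ i, matSeq (M * (W m)ᴴ) i (m + 1) =
      star (star t) * matSeq M i m
        + star (star c) * matSeq (M * (W (m + 1))ᴴ) i (m + 1) := fun i => by
    rw [hWm', matSeq_mul_givens_conjTranspose hm, if_neg (by omega), if_pos rfl,
      hlow i m le_rfl, star_star, star_star]
  have hY₃ : ∀ i k, m + 1 < k → matSeq (M * (W m)ᴴ) i k = matSeq (M * (W (m + 1))ᴴ) i k :=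
    fun i k hk => by
      rw [hWm', matSeq_mul_givens_conjTranspose hm, if_neg (by omega), if_neg (by omega)]
  have hq₁ : vecSeq (W m *ᵥ q) m = c * vecSeq q m - t * vecSeq (W (m + 1) *ᵥ q) (m + 1) := by
    rw [hWm, ← Matrix.mulVec_mulVec, vecSeq_givens_mulVec hm, if_pos rfl,
      hW.vecSeq_mulVec (Nat.zero_le _) (by omega) q (Nat.lt_succ_self m)]
  have hq₂ : vecSeq (W m *ᵥ q) (m + 1) =
      star t * vecSeq q m + star c * vecSeq (W (m + 1) *ᵥ q) (m + 1) := by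
    rw [hWm, ← Matrix.mulVec_mulVec, vecSeq_givens_mulVec hm, if_neg (by omega), if_pos rfl,
      hW.vecSeq_mulVec (Nat.zero_le _) (by omega) q (Nat.lt_succ_self m)]
  have hq₃ : ∀ i, m + 1 < i → vecSeq (W m *ᵥ q) i = vecSeq (W (m + 1) *ᵥ q) i :=
    fun i hi => by
      rw [hWm, ← Matrix.mulVec_mulVec, vecSeq_givens_mulVec hm, if_neg (by omega),
        if_neg (by omega)]
  have hqm := h.q_lt m m.lt_succ_self
  have hdm : ‖s.d m * 1 - matSeq M m m‖ ≤ E := by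
    rw [h.d_lt m m.lt_succ_self, mul_one]
    exact hd m (by omega)
  -- The entry `(m, m + 1)` is still a product here and becomes `β` in this pass; the second
  -- alternative in `p_ge` is there for this one entry.
  have hup : ‖-F.cplx.mul (p m) (star (s.q (m + 1))) * 1
      - matSeq (M * (W (m + 1))ᴴ) m (m + 1)‖ ≤ e + 2 * (u * N) := by
    rw [mul_one]
    exact F.norm_neg_mul_sub_le hu (h.p_ge m (m + 1) le_rfl hm (Or.inr (by omega))) (hY _ _) he
  have hqp : ∀ i, i < m → ‖s.q m * -star (p i) - star (matSeq M i m)‖ ≤ E := fun i hi => by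
    rw [← norm_mul_neg_star_sub, hqm]
    exact hp i m hi (by omega)
  have hqp' : ∀ i, i < m → ‖s.q (m + 1) * -star (p i)
      - star (matSeq (M * (W (m + 1))ᴴ) i (m + 1))‖ ≤ e := fun i hi => by
    rw [← norm_mul_neg_star_sub]
    exact h.p_ge i (m + 1) le_rfl hm (Or.inr (by omega))
  refine ⟨?_, ?_, ?_, ?_, ?_, ?_⟩
  · intro i hi
    rw [backStep_d, if_neg (by omega), if_neg (by omega)]
    exact h.d_lt i (by omega)
  · intro i hi
    rw [backStep_q, rotateAt_of_ne _ _ _ _ (by omega) (by omega)]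
    exact h.q_lt i (by omega)
  · intro i hi hin
    rw [backStep_d]
    split_ifs with h1 h2
    · subst h1
      rw [hY₂, ← mul_one (F.apply₂ _ _ _)]
      refine norm_mul_sub_rotation_le' (N := N) (e₁ := E) (e₂ := e) hu (by norm_num) hcs hts
        (F.norm_apply₂_sub_le hu hu' hRs _ _) ?_ ?_ (hMN _ _) (hY _ _) (by linarith) (by linarith)
      · simpa using hγ m hm
      · simpa using h.d_ge (m + 1) le_rfl hm
    · subst h2
      rw [hY₁, ← mul_one (F.apply₁ _ _ _)]
      exact norm_mul_sub_rotation_le (N := N) (e₁ := E) (e₂ := e + 2 * (u * N)) hu (by norm_num)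
        hcs hts (F.norm_apply₁_sub_le hu hu' hRs _ _) hdm hup (hMN _ _) (hY _ _) (by linarith)
        (by linarith)
    · rw [hY₃ i i (by omega)]
      linarith [h.d_ge i (by omega) hin]
  · intro i hi hin
    rw [backStep_β]
    split_ifs with h1
    · subst h1
      rw [hY₂, ← mul_one (F.apply₂ _ _ _)]
      exact norm_mul_sub_rotation_le' (N := N) (e₁ := E) (e₂ := e + 2 * (u * N)) hu (by norm_num)
        hcs hts (F.norm_apply₂_sub_le hu hu' hRs _ _) hdm hup (hMN _ _) (hY _ _) (by linarith)
        (by linarith)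
    · rw [hY₃ i (i + 1) (by omega)]
      linarith [h.β_ge i (by omega) hin]
  · intro i k hk hkn hik
    rw [backStep_q]
    by_cases h1 : k = m
    · subst h1
      -- Conjugation turns the column operation on the entry into the row rotation that acts on `q`.
      rw [rotateAt_self, norm_mul_neg_star_sub, hY₁, star_sub, star_mul', star_mul', star_star,
        star_star]
      exact norm_mul_sub_rotation_le (N := N) (e₁ := E) (e₂ := e) hu (by norm_num) hc ht
        (F.norm_apply₁_sub_le hu hu' hR _ _) (hqp i (by omega)) (hqp' i (by omega))
        (by rw [norm_star]; exact hMN _ _) (by rw [norm_star]; exact hY _ _) (by linarith)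
        (by linarith)
    · by_cases h2 : k = m + 1
      · subst h2
        rw [rotateAt_succ, norm_mul_neg_star_sub, hY₂, star_add, star_mul', star_mul', star_star,
          star_star]
        exact norm_mul_sub_rotation_le' (N := N) (e₁ := E) (e₂ := e) hu (by norm_num) hc ht
          (F.norm_apply₂_sub_le hu hu' hR _ _) (hqp i (by omega)) (hqp' i (by omega))
          (by rw [norm_star]; exact hMN _ _) (by rw [norm_star]; exact hY _ _) (by linarith)
          (by linarith)
      · rw [hY₃ i k (by omega), rotateAt_of_ne _ _ _ _ h1 h2]
        linarith [h.p_ge i k (by omega) hkn (by omega)]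
  · intro i hi hin
    rw [backStep_q]
    by_cases h1 : i = m
    · subst h1
      rw [hq₁, rotateAt_self, ← mul_one (F.apply₁ _ _ _)]
      refine norm_mul_sub_rotation_le (N := N') (e₁ := 0) (e₂ := e') hu (by norm_num) hc ht
        (F.norm_apply₁_sub_le hu hu' hR _ _) ?_ ?_ (hqN _) (hYq _) (by linarith) (by linarith)
      · simp [hqm]
      · simpa using h.q_err (i + 1) le_rfl hm
    · by_cases h2 : i = m + 1
      · subst h2
        rw [hq₂, rotateAt_succ, ← mul_one (F.apply₂ _ _ _)]
        refine norm_mul_sub_rotation_le' (N := N') (e₁ := 0) (e₂ := e') hu (by norm_num) hc ht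
          (F.norm_apply₂_sub_le hu hu' hR _ _) ?_ ?_ (hqN _) (hYq _) (by linarith) (by linarith)
        · simp [hqm]
        · simpa using h.q_err (m + 1) le_rfl hm
      · rw [hq₃ i (by omega), rotateAt_of_ne _ _ _ _ h1 h2]
        linarith [h.q_err i (by omega) hin]

/-- The matrix error starts from `E`, left by the elimination, while `q` starts exact. -/
lemma BackInvariant.loop (hu : 0 ≤ u) (hu' : u ≤ 1 / 1000) (hW : RotationChain u 0 Q W)
    (hd : ∀ i < n, ‖d i - matSeq M i i‖ ≤ E)
    (hγ : ∀ i, i + 1 < n → ‖γ i - matSeq M (i + 1) i‖ ≤ E)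
    (hp : ∀ i k, i < k → k < n → ‖p i * -star (vecSeq q k) - matSeq M i k‖ ≤ E)
    (hE0 : 0 ≤ E) (m : ℕ) :
    ∀ {s : BackState} {k : ℝ}, m ≤ n - 1 → 0 ≤ k →
      E + (k + m) * (E + 10 ^ 4 * u * ‖M‖) ≤ ‖M‖ → 10 ^ 4 * (k + m) * u ≤ 1 →
      BackInvariant M d p q m W s (E + k * (E + 10 ^ 4 * u * ‖M‖))
        (10 ^ 4 * k * u * ‖WithLp.toLp 2 q‖) →
      BackInvariant M d p q 0 W (F.backLoop Q γ p m s)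
        (E + (k + m) * (E + 10 ^ 4 * u * ‖M‖)) (10 ^ 4 * (k + m) * u * ‖WithLp.toLp 2 q‖) := by
  induction m with
  | zero =>
    intro s k _ _ _ _ h
    simpa [backLoop] using h
  | succ m ih =>
    intro s k hm hk hkE hku h
    push_cast at hku hkE
    have hη : 0 ≤ E + 10 ^ 4 * u * ‖M‖ := by positivity
    have hmη : 0 ≤ (m : ℝ) * (E + 10 ^ 4 * u * ‖M‖) := by positivity
    have hkη : 0 ≤ k * (E + 10 ^ 4 * u * ‖M‖) := by positivity
    have hmu : 0 ≤ (m : ℝ) * u := by positivity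
    have h₁ := BackInvariant.step F hu hu' hW (by omega) hd hγ hp h hE0 (by linarith)
      (by linarith) (by positivity) (mul_le_of_le_one_left (norm_nonneg _) (by linarith))
    have e₁ : E + k * (E + 10 ^ 4 * u * ‖M‖) + (E + 10 ^ 4 * u * ‖M‖)
        = E + (k + 1) * (E + 10 ^ 4 * u * ‖M‖) := by ring
    have e₂ : ∀ x : ℝ, 10 ^ 4 * k * u * x + 10 ^ 4 * u * x = 10 ^ 4 * (k + 1) * u * x :=
      fun x => by ring
    rw [e₁, e₂] at h₁
    have e₃ : k + ((m + 1 : ℕ) : ℝ) = k + 1 + m := by push_cast; ring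
    rw [e₃]
    exact ih (by omega) (by positivity) (by linarith) (by linarith) h₁

lemma backInvariant_init (hW : RotationChain u 0 Q W) (hd : ∀ i < n, ‖d i - matSeq M i i‖ ≤ E)
    (hp : ∀ i k, i < k → k < n → ‖p i * -star (vecSeq q k) - matSeq M i k‖ ≤ E) :
    BackInvariant M d p q (n - 1) W { d := d, β := fun _ => 0, q := vecSeq q } E 0 where
  d_lt _ _ := rfl
  q_lt _ _ := rfl
  d_ge i _ hi := by simpa [hW.last] using hd i hi
  β_ge i _ _ := by omega
  p_ge i k _ hk hik := by simpa [hW.last] using hp i k (by omega) hk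
  q_err i _ _ := by simp [hW.last]

end FloatArith

/-! ### From entrywise errors to backward errors -/

/-- Entrywise closeness of the matrix given by generators to a Hermitian matrix only has to be
checked on the generators. -/
lemma norm_generatedMatrix_sub_le {n : ℕ} {B : Matrix (Fin n) (Fin n) ℂ} (hB : B.IsHermitian)
    {d β p q : ℕ → ℂ} {e : ℝ} (hd : ∀ i < n, ‖d i - matSeq B i i‖ ≤ e)
    (hβ : ∀ i, i + 1 < n → ‖β i - matSeq B i (i + 1)‖ ≤ e)
    (hp : ∀ i k, i + 1 < k → k < n → ‖p i * -star (q k) - matSeq B i k‖ ≤ e) (i k : Fin n) :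
    ‖(generatedMatrix n d β p q - B) i k‖ ≤ e := by
  rw [Matrix.sub_apply, ← matSeq_fin B]
  simp only [generatedMatrix, Matrix.of_apply]
  split_ifs with h1 h2 h3 h4
  · simpa using hp i k h1 k.2
  · rw [h2]
    exact hβ i (by omega)
  · rw [h3]
    exact hd i i.2
  · rw [h4, ← hB.star_matSeq, ← star_sub, norm_star]
    exact hβ k (by omega)
  · have := hp k i (by omega) i.2
    rw [norm_mul_neg_star_sub, hB.star_matSeq] at this
    simpa using this

section Backward

variable {n : ℕ} {U : Matrix (Fin n) (Fin n) ℂ}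

/-- The forward error is pulled back by `U`, which preserves its norm: `δ = Uᴴ * B * U - A`. -/
lemma exists_backward_error_matrix (hU : U ∈ Matrix.unitaryGroup (Fin n) ℂ)
    (A B : Matrix (Fin n) (Fin n) ℂ) :
    ∃ δ : Matrix (Fin n) (Fin n) ℂ, B = U * (A + δ) * Uᴴ ∧ ‖δ‖ = ‖B - U * A * Uᴴ‖ := by
  have h1 : U * Uᴴ = 1 := Matrix.mem_unitaryGroup_iff.mp hU
  have e : U * (Uᴴ * B * U - A) * Uᴴ = B - U * A * Uᴴ := by
    calc _ = (U * Uᴴ) * B * (U * Uᴴ) - U * A * Uᴴ := by noncomm_ring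
      _ = _ := by rw [h1, Matrix.one_mul, Matrix.mul_one]
  refine ⟨Uᴴ * B * U - A, ?_, ?_⟩
  · rw [Matrix.mul_add, Matrix.add_mul, e]
    abel
  · rw [← e, frobenius_norm_mul_conjTranspose_unitary hU, frobenius_norm_unitary_mul hU]

lemma exists_backward_error_vector (hU : U ∈ Matrix.unitaryGroup (Fin n) ℂ) (v w : Fin n → ℂ) :
    ∃ δ : Fin n → ℂ, w = U *ᵥ (v + δ) ∧ ‖WithLp.toLp 2 δ‖ = ‖WithLp.toLp 2 (w - U *ᵥ v)‖ := by
  have h1 : U * Uᴴ = 1 := Matrix.mem_unitaryGroup_iff.mp hU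
  have e : U *ᵥ (Uᴴ *ᵥ w - v) = w - U *ᵥ v := by
    rw [Matrix.mulVec_sub, Matrix.mulVec_mulVec, h1, Matrix.one_mulVec]
  refine ⟨Uᴴ *ᵥ w - v, ?_, ?_⟩
  · rw [Matrix.mulVec_add, e]
    abel
  · rw [← e, norm_toLp_mulVec_unitary hU]

end Backward

namespace FloatArith

variable {u : ℝ} (F : FloatArith u) {n : ℕ} {A : Matrix (Fin n) (Fin n) ℂ} {p q : Fin n → ℂ}

/-- Entrywise forward error bounds for one QR iteration. -/
lemma exists_unitary_qr_entrywise (hu : 0 ≤ u) (hnu : 10 ^ 4 * (n + 1) ^ 2 * u ≤ 1)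
    (hA : A.IsHermitian) (hH : IsLowerHessenberg (A + Matrix.vecMulVec p (star q))) :
    ∃ U ∈ Matrix.unitaryGroup (Fin n) ℂ,
      (∀ i k, ‖(F.qrA A p q - U * A * Uᴴ) i k‖ ≤ 10 ^ 4 * n ^ 2 * u * ‖A‖) ∧
      (∀ i, ‖(F.qrP A p q - U *ᵥ p) i‖ ≤ 10 ^ 4 * n * u * ‖WithLp.toLp 2 p‖) ∧
      (∀ i, ‖(F.qrQ A p q - U *ᵥ q) i‖ ≤ 10 ^ 4 * n * u * ‖WithLp.toLp 2 q‖) := by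
  rcases Nat.eq_zero_or_pos n with rfl | hn
  · exact ⟨1, one_mem _, fun i => i.elim0, fun i => i.elim0, fun i => i.elim0⟩
  have hn0 : (0 : ℝ) ≤ n := Nat.cast_nonneg n
  have hnu0 : 0 ≤ (n : ℝ) * u := by positivity
  have hn2u : 0 ≤ (n : ℝ) ^ 2 * u := by positivity
  -- Every smallness condition needed below is supplied by one of these three terms.
  have hexp : 10 ^ 4 * (n + 1 : ℝ) ^ 2 * u
      = 10 ^ 4 * (n : ℝ) ^ 2 * u + 2 * 10 ^ 4 * ((n : ℝ) * u) + 10 ^ 4 * u := by ring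
  have hu' : u ≤ 1 / 1000 := by linarith
  obtain ⟨W, h⟩ := F.exists_elimInvariant_qrElim hu hu' (by linarith) hA hH
  have hU := h.chain.mem 0
  have hcast : ((n - 1 : ℕ) : ℝ) = n - 1 := by rw [Nat.cast_sub hn, Nat.cast_one]
  have hMA : ‖W 0 * A‖ = ‖A‖ := frobenius_norm_unitary_mul hU A
  have hd : ∀ i < n, ‖(F.qrElim A p q).d i - matSeq (W 0 * A) i i‖ ≤
      10 ^ 4 * (n - 1 : ℕ) * u * ‖A‖ := fun i hi => h.d_ge i (Nat.zero_le _) hi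
  have hγ : ∀ i, i + 1 < n → ‖(F.qrElim A p q).γ i - matSeq (W 0 * A) (i + 1) i‖ ≤
      10 ^ 4 * (n - 1 : ℕ) * u * ‖A‖ := fun i hi => h.γ_ge i (Nat.zero_le _) hi
  have hp : ∀ i k, i < k → k < n → ‖(F.qrElim A p q).p i * -star (vecSeq q k)
      - matSeq (W 0 * A) i k‖ ≤ 10 ^ 4 * (n - 1 : ℕ) * u * ‖A‖ :=
    fun i k hik hk => h.p_ge i k (Nat.zero_le _) hik hk
  have hE : 10 ^ 4 * (n - 1 : ℕ) * u * ‖A‖ + (0 + (n - 1 : ℕ)) *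
      (10 ^ 4 * (n - 1 : ℕ) * u * ‖A‖ + 10 ^ 4 * u * ‖W 0 * A‖)
      ≤ 10 ^ 4 * n ^ 2 * u * ‖A‖ := by
    rw [hMA, hcast]
    -- The passes sum to `(n - 1) + (n - 1) * n = n ^ 2 - 1`.
    have e : 10 ^ 4 * (n - 1 : ℝ) * u * ‖A‖ + (0 + (n - 1 : ℝ)) *
        (10 ^ 4 * (n - 1) * u * ‖A‖ + 10 ^ 4 * u * ‖A‖)
        = 10 ^ 4 * (n ^ 2 - 1) * u * ‖A‖ := by ring
    rw [e]
    gcongr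
    linarith
  have hb := BackInvariant.loop F hu hu' h.chain hd hγ hp (by positivity) (n - 1)
    (k := 0) le_rfl le_rfl
    (hE.trans (by rw [hMA]; exact mul_le_of_le_one_left (norm_nonneg _) (by linarith)))
    (by rw [hcast]; linarith)
    (by simpa using backInvariant_init h.chain hd hp)
  change BackInvariant _ _ _ q 0 W (F.qrBack A p q) _ _ at hb
  have hB : (W 0 * A * (W 0)ᴴ).IsHermitian := Matrix.isHermitian_mul_mul_conjTranspose _ hA
  have hvec : ∀ x : ℝ, 0 ≤ x → 10 ^ 4 * ((n - 1 : ℕ) : ℝ) * u * x ≤ 10 ^ 4 * n * u * x := by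
    intro x hx
    rw [hcast]
    gcongr
    linarith
  refine ⟨W 0, hU, ?_, ?_, ?_⟩
  · exact norm_generatedMatrix_sub_le hB
      (fun i hi => (hb.d_ge i (Nat.zero_le _) hi).trans hE)
      (fun i hi => (hb.β_ge i (Nat.zero_le _) hi).trans hE)
      (fun i k hik hk => (hb.p_ge i k (Nat.zero_le _) hk (Or.inl hik)).trans hE)
  · intro i
    rw [Pi.sub_apply, ← vecSeq_fin (W 0 *ᵥ p)]
    exact (h.p_err i (Nat.zero_le _) i.2).trans (hvec _ (norm_nonneg _))
  · intro i
    rw [Pi.sub_apply, ← vecSeq_fin (W 0 *ᵥ q)]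
    have := hb.q_err i (Nat.zero_le _) i.2
    rw [zero_add] at this
    exact this.trans (hvec _ (norm_nonneg _))

end FloatArith

theorem lemma4p3 :
    ∃ P : Polynomial ℝ, P.natDegree ≤ 3 ∧
      ∀ n : ℕ, ∃ u₀ : ℝ, 0 < u₀ ∧
        ∀ u : ℝ, 0 ≤ u → u ≤ u₀ → ∀ F : FloatArith u,
        ∀ (A : Matrix (Fin n) (Fin n) ℂ) (p q : Fin n → ℂ),
          A.IsHermitian → IsLowerHessenberg (A + Matrix.vecMulVec p (star q)) →
          ∃ U ∈ Matrix.unitaryGroup (Fin n) ℂ,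
          ∃ (δA : Matrix (Fin n) (Fin n) ℂ) (δp δq : Fin n → ℂ),
            F.qrA A p q = U * (A + δA) * Uᴴ ∧
            F.qrP A p q = U *ᵥ (p + δp) ∧
            F.qrQ A p q = U *ᵥ (q + δq) ∧
            ‖δA‖ ≤ P.eval (n : ℝ) * u * ‖A‖ ∧
            ‖WithLp.toLp 2 δp‖ ≤ P.eval (n : ℝ) * u * ‖WithLp.toLp 2 p‖ ∧
            ‖WithLp.toLp 2 δq‖ ≤ P.eval (n : ℝ) * u * ‖WithLp.toLp 2 q‖ := by
  -- Quadratic entrywise errors times `n` for the Frobenius norm give the cubic. The choice of `u₀`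
  -- keeps accumulated errors below the norms of the data; `n + 1` in place of `n` also forces `u ≤
  -- 1 / 1000`.
  refine ⟨Polynomial.C (10 ^ 4) * Polynomial.X ^ 3, Polynomial.natDegree_C_mul_X_pow_le _ _,
    fun n => ⟨(10 ^ 4 * (n + 1 : ℝ) ^ 2)⁻¹, by positivity, ?_⟩⟩
  intro u hu hu₀ F A p q hA hH
  have hnu : 10 ^ 4 * (n + 1 : ℝ) ^ 2 * u ≤ 1 := by
    have hpos : (0 : ℝ) < 10 ^ 4 * (n + 1 : ℝ) ^ 2 := by positivity
    calc _ ≤ 10 ^ 4 * (n + 1 : ℝ) ^ 2 * (10 ^ 4 * (n + 1 : ℝ) ^ 2)⁻¹ := by gcongr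
      _ = 1 := mul_inv_cancel₀ hpos.ne'
  obtain ⟨U, hU, h1, h2, h3⟩ := F.exists_unitary_qr_entrywise hu hnu hA hH
  obtain ⟨δA, eA, nA⟩ := exists_backward_error_matrix hU A (F.qrA A p q)
  obtain ⟨δp, ep, np⟩ := exists_backward_error_vector hU p (F.qrP A p q)
  obtain ⟨δq, eq, nq⟩ := exists_backward_error_vector hU q (F.qrQ A p q)
  have hP : (Polynomial.C (10 ^ 4) * Polynomial.X ^ 3 : Polynomial ℝ).eval (n : ℝ)
      = 10 ^ 4 * (n : ℝ) ^ 3 := by simp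
  have h23 : (n : ℝ) ^ 2 ≤ (n : ℝ) ^ 3 := by
    rcases Nat.eq_zero_or_pos n with rfl | hn
    · simp
    · exact_mod_cast Nat.pow_le_pow_right hn (by norm_num)
  have hvec : ∀ x : ℝ, 0 ≤ x → n * (10 ^ 4 * n * u * x) ≤ 10 ^ 4 * (n : ℝ) ^ 3 * u * x := by
    intro x hx
    calc _ = 10 ^ 4 * (n : ℝ) ^ 2 * u * x := by ring
      _ ≤ _ := by gcongr
  refine ⟨U, hU, δA, δp, δq, eA, ep, eq, ?_, ?_, ?_⟩
  · rw [nA, hP]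
    exact (frobenius_norm_le_of_forall (by positivity) h1).trans_eq (by ring)
  · rw [np, hP]
    exact (norm_toLp_le_of_forall (by positivity) h2).trans (hvec _ (norm_nonneg _))
  · rw [nq, hP]
    exact (norm_toLp_le_of_forall (by positivity) h3).trans (hvec _ (norm_nonneg _))
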